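/- Let $R$ be a commutative unital ring, $t\in R$, and $\sigma:R\to R$ a unital ring endomorphism that is essential: for every maximal ideal $\mathbf m$ of $R$ the composite $\sigma(R)\hookrightarrow R\to R/\mathbf m$ is surjective. Let $A=A(R,\sigma,t)$ be the weak generalized Weyl algebra generated over $R$ by $X,Y$ with relations $YX=t$, $XY=\sigma(t)$, $Xr=\sigma(r)X$, $rY=Y\sigma(r)$ for $r\in R$. A (left) $A$-module $V$ is a weight module if $V=\bigoplus_{\mathbf m\in\mathrm{Max}(R)}V_{\mathbf m}$, where $V_{\mathbf m}=\{v\in V:\mathbf m v=0\}$. Bounded string modules. Let $n\ge 0$ and let $\mathbf m_0,\dots,\mathbf m_n$ be maximal ideals of $R$ with $\sigma(\mathbf m_i)\subset\mathbf m_{i+1}$ for $0\le i<n$, $\sigma(t)\in\mathbf m_0$ and $t\in\mathbf m_n$. The associated bounded string module is $\bigoplus_{i=0}^n R/\mathbf m_i$ with its natural $R$-action, where $X(r+\mathbf m_i)=\sigma(tr)+\mathbf m_{i+1}$ for $i<n$, $X(R/\mathbf m_n)=0$, $Y(r+\mathbf m_i)=s+\mathbf m_{i-1}$ for any $s$ with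 $\sigma(s)\in r+\mathbf m_i$ for $i>0$, and $Y(R/\mathbf m_0)=0$. Band modules. Let $(\mathbf m_i)_{i\in\mathbb Z}$ be a sequence of maximal ideals of $R$ with $\sigma(\mathbf m_i)\subset\mathbf m_{i+1}$ for all $i$, periodic with minimal period $k\ge 1$. Put $\Bbbk=R/\mathbf m_0$, let $\tau_i:\Bbbk\to R/\mathbf m_i$ ($i\geq 0$) be the isomorphism $r+\mathbf m_0\mapsto\sigma^i(r)+\mathbf m_i$, and let $\bar\sigma$ be the automorphism $r+\mathbf m_0\mapsto\sigma^k(r)+\mathbf m_0$ of $\Bbbk$. Let $\mathbf P=\Bbbk[\alpha,\alpha^{-1};\bar\sigma]$ be the skew Laurent polynomial ring with $\alpha c=\bar\sigma(c)\alpha$ for $c\in\Bbbk$, let $f\in\mathbf P$ be irreducible, and let $L_f=\mathbf P/\mathbf Pf$. The band modules attached to these data are the following two $A$-modules. (a) $M^f=\bigoplus_{i=0}^{k-1}M_i$ with $M_i=L_f$ as abelian groups, where $r\in R$ acts on $M_i$ as $\sigma^i(r)+\mathbf m_0\in\Bbbk$ acts on $L_f$ (so $M_i$ has weight $\mathbf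 m_{-i}$); $Y:M_i\to M_{i+1}$ is the identity for $0\le i<k-1$, $Y:M_{k-1}\to M_0$ is the action of $\alpha^{-1}$, and $X$ is given by $X(Yv)=\sigma(t)v$. (b) $N^f=\bigoplus_{i=0}^{k-1}N_i$ with $N_i=L_f$ as abelian groups, where $r\in R$ acts on $N_i$ as $\tau_i^{-1}(r+\mathbf m_i)\in\Bbbk$ acts on $L_f$ (so $N_i$ has weight $\mathbf m_i$); $X:N_i\to N_{i+1}$ is the identity for $0\le i<k-1$, $X:N_{k-1}\to N_0$ is the action of $\alpha$, and $Y$ is given by $Y(Xv)=tv$. Then the simple weight $A$-modules of finite length as $R$-modules are exactly the simple bounded string modules and the band modules. That is, an $A$-module $V$ is a simple weight module of finite length over $R$ if and only if $V$ is simple and isomorphic to a bounded string module, or $V$ is isomorphic to a band module. -/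

import Mathlib

universe u v

/-! ### Weak generalized Weyl algebras -/

section Algebra

variable {R : Type u} [CommRing R]

/-- Generators of a weak generalized Weyl algebra: the elements of `R`, and `X`, `Y`. -/
inductive WGWAGen (R : Type u) : Type u
  | coef : R → WGWAGen R
  | X : WGWAGen R
  | Y : WGWAGen R

/-- The defining relations. The first three make `R → A` a unital ring homomorphism; the other
four are `YX = t`, `XY = σ(t)`, `Xr = σ(r)X`, `rY = Yσ(r)`. -/
inductive WGWARel (σ : R →+* R) (t : R) :
    FreeAlgebra ℤ (WGWAGen R) → FreeAlgebra ℤ (WGWAGen R) → Prop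
  | one : WGWARel σ t (FreeAlgebra.ι ℤ (.coef 1)) 1
  | add (r s : R) : WGWARel σ t (FreeAlgebra.ι ℤ (.coef (r + s)))
      (FreeAlgebra.ι ℤ (.coef r) + FreeAlgebra.ι ℤ (.coef s))
  | mul (r s : R) : WGWARel σ t (FreeAlgebra.ι ℤ (.coef (r * s)))
      (FreeAlgebra.ι ℤ (.coef r) * FreeAlgebra.ι ℤ (.coef s))
  | YX : WGWARel σ t (FreeAlgebra.ι ℤ .Y * FreeAlgebra.ι ℤ .X) (FreeAlgebra.ι ℤ (.coef t))
  | XY : WGWARel σ t (FreeAlgebra.ι ℤ .X * FreeAlgebra.ι ℤ .Y) (FreeAlgebra.ι ℤ (.coef (σ t)))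
  | Xr (r : R) : WGWARel σ t (FreeAlgebra.ι ℤ .X * FreeAlgebra.ι ℤ (.coef r))
      (FreeAlgebra.ι ℤ (.coef (σ r)) * FreeAlgebra.ι ℤ .X)
  | rY (r : R) : WGWARel σ t (FreeAlgebra.ι ℤ (.coef r) * FreeAlgebra.ι ℤ .Y)
      (FreeAlgebra.ι ℤ .Y * FreeAlgebra.ι ℤ (.coef (σ r)))

/-- The weak generalized Weyl algebra `A(R, σ, t)` of rank one. -/
def WGWA (σ : R →+* R) (t : R) : Type u := RingQuot (WGWARel σ t)

noncomputable instance (σ : R →+* R) (t : R) : Ring (WGWA σ t) :=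
  inferInstanceAs (Ring (RingQuot (WGWARel σ t)))

namespace WGWA

/-- The quotient map from the free ring on the generators. -/
noncomputable def proj (σ : R →+* R) (t : R) : FreeAlgebra ℤ (WGWAGen R) →+* WGWA σ t :=
  RingQuot.mkRingHom (WGWARel σ t)

theorem proj_rel {σ : R →+* R} {t : R} {a b : FreeAlgebra ℤ (WGWAGen R)}
    (h : WGWARel σ t a b) : proj σ t a = proj σ t b :=
  RingQuot.mkRingHom_rel h

/-- The generator `X` of `A`. -/
noncomputable def X (σ : R →+* R) (t : R) : WGWA σ t := proj σ t (FreeAlgebra.ι ℤ .X)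

/-- The generator `Y` of `A`. -/
noncomputable def Y (σ : R →+* R) (t : R) : WGWA σ t := proj σ t (FreeAlgebra.ι ℤ .Y)

/-- The structural ring homomorphism `R → A`. -/
noncomputable def coef (σ : R →+* R) (t : R) : R →+* WGWA σ t :=
  RingHom.mk'
    { toFun := fun r => proj σ t (FreeAlgebra.ι ℤ (.coef r))
      map_one' := by rw [proj_rel .one, map_one]
      map_mul' := fun r s => by rw [proj_rel (.mul r s), map_mul] }
    (fun r s => by
      change proj σ t _ = proj σ t _ + proj σ t _
      rw [proj_rel (.add r s), map_add])

/-- An `R`-module structure together with additive operators `X`, `Y` satisfying the defining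
relations, i.e. a representation of `A(R, σ, t)` on the additive group `M`. -/
structure Rep (σ : R →+* R) (t : R) (M : Type v) [AddCommGroup M] where
  ρ : R →+* AddMonoid.End M
  x : M →+ M
  y : M →+ M
  yx : ∀ v, y (x v) = ρ t v
  xy : ∀ v, x (y v) = ρ (σ t) v
  xr : ∀ r v, x (ρ r v) = ρ (σ r) (x v)
  ry : ∀ r v, ρ r (y v) = y (ρ (σ r) v)

namespace Rep

variable {σ : R →+* R} {t : R} {M : Type v} [AddCommGroup M] (S : Rep σ t M)

/-- The images of the generators. -/
def onGen : WGWAGen R → AddMonoid.End M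
  | .coef r => S.ρ r
  | .X => S.x
  | .Y => S.y

/-- The ring homomorphism `A → End(M)` given by a representation. -/
noncomputable def toHom : WGWA σ t →+* AddMonoid.End M :=
  RingQuot.lift ⟨(FreeAlgebra.lift ℤ S.onGen : FreeAlgebra ℤ (WGWAGen R) →+* AddMonoid.End M), by
    intro a b h
    cases h with
    | one => simp [onGen]
    | add r s => simp [onGen]
    | mul r s => simp [onGen]
    | YX =>
      simp only [RingHom.coe_coe, map_mul, FreeAlgebra.lift_ι_apply, onGen]
      exact AddMonoidHom.ext S.yx
    | XY =>
      simp only [RingHom.coe_coe, map_mul, FreeAlgebra.lift_ι_apply, onGen]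
      exact AddMonoidHom.ext S.xy
    | Xr r =>
      simp only [RingHom.coe_coe, map_mul, FreeAlgebra.lift_ι_apply, onGen]
      exact AddMonoidHom.ext (S.xr r)
    | rY r =>
      simp only [RingHom.coe_coe, map_mul, FreeAlgebra.lift_ι_apply, onGen]
      exact AddMonoidHom.ext (S.ry r)⟩

theorem toHom_proj (a : FreeAlgebra ℤ (WGWAGen R)) :
    S.toHom (proj σ t a) = FreeAlgebra.lift ℤ S.onGen a :=
  RingQuot.lift_mkRingHom_apply _ _ _

@[simp] theorem toHom_X : S.toHom (X σ t) = S.x := by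
  rw [X, toHom_proj, FreeAlgebra.lift_ι_apply, onGen]

@[simp] theorem toHom_Y : S.toHom (Y σ t) = S.y := by
  rw [Y, toHom_proj, FreeAlgebra.lift_ι_apply, onGen]

@[simp] theorem toHom_coef (r : R) : S.toHom (coef σ t r) = S.ρ r := by
  change S.toHom (proj σ t _) = _
  simp [toHom_proj, onGen]

/-- The `A`-module structure on `M` given by a representation. -/
noncomputable abbrev module : Module (WGWA σ t) M := Module.compHom M S.toHom

/-- If `Y` is bijective with `rY = Yσ(r)`, setting `X(Yv) := σ(t)v` gives a representation. -/
def ofY (σ : R →+* R) (t : R) (ρ : R →+* AddMonoid.End M) (y : M ≃+ M)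
    (h : ∀ r v, ρ r (y v) = y (ρ (σ r) v)) : Rep σ t M where
  ρ := ρ
  x := (ρ (σ t)).comp y.symm.toAddMonoidHom
  y := y.toAddMonoidHom
  yx v := by
    change y (ρ (σ t) (y.symm v)) = _
    rw [← h, y.apply_symm_apply]
  xy v := by
    change ρ (σ t) (y.symm (y v)) = _
    rw [y.symm_apply_apply]
  xr r v := by
    change ρ (σ t) (y.symm (ρ r v)) = ρ (σ r) (ρ (σ t) (y.symm v))
    have h1 : y.symm (ρ r v) = ρ (σ r) (y.symm v) := by
      rw [AddEquiv.symm_apply_eq, ← h, y.apply_symm_apply]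
    have h2 : ρ (σ t) * ρ (σ r) = ρ (σ r) * ρ (σ t) := by
      rw [← map_mul ρ, ← map_mul ρ, mul_comm]
    rw [h1]
    exact DFunLike.congr_fun h2 (y.symm v)
  ry r v := h r v

/-- If `X` is bijective with `Xr = σ(r)X`, setting `Y(Xv) := tv` gives a representation. -/
def ofX (σ : R →+* R) (t : R) (ρ : R →+* AddMonoid.End M) (x : M ≃+ M)
    (h : ∀ r v, x (ρ r v) = ρ (σ r) (x v)) : Rep σ t M where
  ρ := ρ
  x := x.toAddMonoidHom
  y := (ρ t).comp x.symm.toAddMonoidHom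
  yx v := by
    change ρ t (x.symm (x v)) = _
    rw [x.symm_apply_apply]
  xy v := by
    change x (ρ t (x.symm v)) = _
    rw [h, x.apply_symm_apply]
  xr r v := h r v
  ry r v := by
    change ρ r (ρ t (x.symm v)) = ρ t (x.symm (ρ (σ r) v))
    have h1 : x.symm (ρ (σ r) v) = ρ r (x.symm v) := by
      rw [AddEquiv.symm_apply_eq, h, x.apply_symm_apply]
    have h2 : ρ r * ρ t = ρ t * ρ r := by
      rw [← map_mul ρ, ← map_mul ρ, mul_comm]
    rw [h1]
    exact DFunLike.congr_fun h2 (x.symm v)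

end Rep

/-! ### Weight modules and finite length over `R` -/

/-- The weight space `V_𝔪 = {v | 𝔪 v = 0}`. -/
def weightSpace (σ : R →+* R) (t : R) (V : Type v) [AddCommGroup V] [Module (WGWA σ t) V]
    (m : MaximalSpectrum R) : AddSubgroup V where
  carrier := {v | ∀ r ∈ m.asIdeal, coef σ t r • v = 0}
  zero_mem' := fun r _ => smul_zero _
  add_mem' := fun {a b} ha hb r hr => by rw [smul_add, ha r hr, hb r hr, add_zero]
  neg_mem' := fun {a} ha r hr => by rw [smul_neg, ha r hr, neg_zero]

open Classical in
/-- `V` is a weight module: it is the direct sum of its weight spaces over all of `Max(R)`. -/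
def IsWeight (σ : R →+* R) (t : R) (V : Type v) [AddCommGroup V] [Module (WGWA σ t) V] : Prop :=
  DirectSum.IsInternal (weightSpace σ t V)

/-- `V` has finite length as an `R`-module, `R` acting through `R → A`. -/
def FiniteLengthOverBase (σ : R →+* R) (t : R) (V : Type v) [AddCommGroup V]
    [Module (WGWA σ t) V] : Prop :=
  let _ : Module R V := Module.compHom V (coef σ t)
  IsFiniteLength R V

/-! ### Essential endomorphisms -/

/-- `σ` is essential: for every maximal ideal `𝔪` the map `σ(R) → R/𝔪` (equivalently the
canonical inclusion `σ(R)/(σ(R) ∩ 𝔪) → R/𝔪`) is surjective. -/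
def IsEssential (σ : R →+* R) : Prop :=
  ∀ m : MaximalSpectrum R,
    Function.Surjective ((Ideal.Quotient.mk m.asIdeal).comp σ.range.subtype)

/-- `n ← m`, i.e. `σ(n) ⊆ m`. -/
def Below (σ : R →+* R) (n m : MaximalSpectrum R) : Prop :=
  n.asIdeal ≤ m.asIdeal.comap σ

/-- The residue field `R/𝔪`. -/
abbrev Res (m : MaximalSpectrum R) : Type u := R ⧸ m.asIdeal

theorem res_injective {σ : R →+* R} {n m : MaximalSpectrum R} (h : Below σ n m) :
    Function.Injective (Ideal.quotientMap m.asIdeal σ h) := by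
  let _ := Ideal.Quotient.field n.asIdeal
  exact RingHom.injective _

/-- The field isomorphism `R/𝔫 ≃ R/𝔪`, `r + 𝔫 ↦ σ(r) + 𝔪`, when `σ(𝔫) ⊆ 𝔪` and `σ` is
essential. -/
noncomputable def resEquiv {σ : R →+* R} (hσ : IsEssential σ) {n m : MaximalSpectrum R}
    (h : Below σ n m) : Res n ≃+* Res m :=
  RingEquiv.ofBijective (Ideal.quotientMap m.asIdeal σ h) ⟨res_injective h, fun y => by
    obtain ⟨⟨_, s, rfl⟩, hs⟩ := hσ m y
    exact ⟨Ideal.Quotient.mk _ s, hs⟩⟩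

theorem resEquiv_mk {σ : R →+* R} (hσ : IsEssential σ) {n m : MaximalSpectrum R}
    (h : Below σ n m) (r : R) :
    resEquiv hσ h (Ideal.Quotient.mk _ r) = Ideal.Quotient.mk _ (σ r) := rfl

theorem resEquiv_smul {σ : R →+* R} (hσ : IsEssential σ) {n m : MaximalSpectrum R}
    (h : Below σ n m) (r : R) (z : Res n) :
    resEquiv hσ h (r • z) = σ r • resEquiv hσ h z := by
  rw [Algebra.smul_def, map_mul, Algebra.smul_def]
  rfl

theorem resEquiv_symm_smul {σ : R →+* R} (hσ : IsEssential σ) {n m : MaximalSpectrum R}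
    (h : Below σ n m) (r : R) (z : Res m) :
    (resEquiv hσ h).symm (σ r • z) = r • (resEquiv hσ h).symm z := by
  rw [RingEquiv.symm_apply_eq, resEquiv_smul, RingEquiv.apply_symm_apply]

theorem smul_res_eq_zero {m : MaximalSpectrum R} {r : R} (hr : r ∈ m.asIdeal) (z : Res m) :
    r • z = 0 := by
  rw [Algebra.smul_def, Ideal.Quotient.algebraMap_eq, Ideal.Quotient.eq_zero_iff_mem.mpr hr,
    zero_mul]

/-! ### Bounded string modules -/

/-- The set `Q_n`: sequences `𝔪_0, …, 𝔪_n` of maximal ideals with `σ(𝔪_i) ⊆ 𝔪_{i+1}`,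
`σ(t) ∈ 𝔪_0` and `t ∈ 𝔪_n`. -/
structure BoundedSeq (σ : R →+* R) (t : R) (n : ℕ) where
  m : Fin (n + 1) → MaximalSpectrum R
  chain : ∀ i : Fin n, Below σ (m i.castSucc) (m i.succ)
  lowest : σ t ∈ (m 0).asIdeal
  highest : t ∈ (m (Fin.last n)).asIdeal

/-- The underlying group `⊕_{i=0}^n R/𝔪_i` of the bounded string module. -/
def BoundedString {σ : R →+* R} (_hσ : IsEssential σ) {t : R} {n : ℕ} (s : BoundedSeq σ t n) :
    Type u := ∀ i : Fin (n + 1), Res (s.m i)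

namespace BoundedString

variable {σ : R →+* R} (hσ : IsEssential σ) {t : R} {n : ℕ} (s : BoundedSeq σ t n)

noncomputable instance : AddCommGroup (BoundedString hσ s) :=
  inferInstanceAs (AddCommGroup (∀ i : Fin (n + 1), Res (s.m i)))

/-- `R` acts componentwise. `X : R/𝔪_i → R/𝔪_{i+1}` is `r ↦ σ(tr)` and kills `R/𝔪_n`.
`Y : R/𝔪_{i+1} → R/𝔪_i` sends `r` to the class of any `s` with `σ(s) ∈ r + 𝔪_{i+1}`, and
kills `R/𝔪_0`. -/
noncomputable def rep : Rep σ t (∀ i : Fin (n + 1), Res (s.m i)) where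
  ρ := Module.toAddMonoidEnd R _
  x :=
    { toFun := fun v => Fin.cons (α := fun i => Res (s.m i)) 0
        (fun i : Fin n => resEquiv hσ (s.chain i) (t • v i.castSucc))
      map_zero' := by
        ext i; refine Fin.cases ?_ (fun i => ?_) i <;> simp
      map_add' := fun v w => by
        ext i; refine Fin.cases ?_ (fun i => ?_) i <;> simp }
  y :=
    { toFun := fun v => Fin.snoc (α := fun i => Res (s.m i))
        (fun i : Fin n => (resEquiv hσ (s.chain i)).symm (v i.succ)) 0
      map_zero' := by
        ext i; refine Fin.lastCases ?_ (fun i => ?_) i <;> simp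
      map_add' := fun v w => by
        ext i; refine Fin.lastCases ?_ (fun i => ?_) i <;> simp }
  yx v := by
    ext i
    refine Fin.lastCases ?_ (fun i => ?_) i
    · change _ = t • v (Fin.last n)
      simp [smul_res_eq_zero s.highest]
    · change _ = t • v i.castSucc
      simp
  xy v := by
    ext i
    refine Fin.cases ?_ (fun i => ?_) i
    · change _ = σ t • v 0
      simp [smul_res_eq_zero s.lowest]
    · change _ = σ t • v i.succ
      simp [resEquiv_smul]
  xr r v := by
    ext i
    refine Fin.cases ?_ (fun i => ?_) i
    · change (0 : Res (s.m 0)) = σ r • (0 : Res (s.m 0))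
      simp
    · change resEquiv hσ (s.chain i) (t • r • v i.castSucc) =
        σ r • resEquiv hσ (s.chain i) (t • v i.castSucc)
      rw [smul_comm, resEquiv_smul]
  ry r v := by
    ext i
    refine Fin.lastCases ?_ (fun i => ?_) i
    · change r • (Fin.snoc (α := fun i => Res (s.m i))
          (fun i : Fin n => (resEquiv hσ (s.chain i)).symm (v i.succ)) 0 : ∀ i, Res (s.m i)) (Fin.last n) = _
      simp
    · change r • (Fin.snoc (α := fun i => Res (s.m i))
          (fun i : Fin n => (resEquiv hσ (s.chain i)).symm (v i.succ)) 0 : ∀ i, Res (s.m i)) i.castSucc =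
        (Fin.snoc (α := fun i => Res (s.m i))
          (fun i : Fin n => (resEquiv hσ (s.chain i)).symm (σ r • v i.succ)) 0 :
            ∀ i, Res (s.m i)) i.castSucc
      simp [resEquiv_symm_smul]

/-- The bounded string module `N_n(𝔪)`. -/
noncomputable instance : Module (WGWA σ t) (BoundedString hσ s) :=
  (rep hσ s).module

end BoundedString

/-! ### Band modules -/

/-- A doubly infinite sequence `(𝔪_i)_{i ∈ ℤ}` of maximal ideals with `σ(𝔪_i) ⊆ 𝔪_{i+1}`,
periodic with minimal period `d + 1`. -/
structure BandSeq (σ : R →+* R) where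
  m : ℤ → MaximalSpectrum R
  chain : ∀ i, Below σ (m i) (m (i + 1))
  d : ℕ
  period : IsLeast {k : ℕ | 0 < k ∧ ∀ i : ℤ, m (i + k) = m i} (d + 1)

namespace BandSeq

variable {σ : R →+* R} (b : BandSeq σ)

theorem below_pow (i : ℕ) : Below (σ ^ i) (b.m 0) (b.m i) := by
  induction i with
  | zero => intro r hr; simpa using hr
  | succ i ih =>
    intro r hr
    have h := b.chain i (ih hr)
    simpa [pow_succ', Ideal.mem_comap] using h

theorem mem_zero_of_period : b.m ((b.d + 1 : ℕ) : ℤ) = b.m 0 := by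
  simpa using b.period.1.2 0

theorem surj_pow (hσ : IsEssential σ) (i : ℕ) (r : R) :
    ∃ s, (σ ^ i) s - r ∈ (b.m i).asIdeal := by
  induction i generalizing r with
  | zero => exact ⟨r, by simp⟩
  | succ i ih =>
    obtain ⟨⟨_, s, rfl⟩, hs⟩ := hσ (b.m ((i + 1 : ℕ) : ℤ)) (Ideal.Quotient.mk _ r)
    obtain ⟨s', hs'⟩ := ih s
    refine ⟨s', ?_⟩
    have h1 : σ s - r ∈ (b.m ((i + 1 : ℕ) : ℤ)).asIdeal := Ideal.Quotient.eq.mp hs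
    have h2 : σ ((σ ^ i) s' - s) ∈ (b.m ((i + 1 : ℕ) : ℤ)).asIdeal := by
      have := b.chain i hs'
      simpa [Ideal.mem_comap] using this
    have h3 := add_mem h2 h1
    simpa [pow_succ', map_sub] using h3

/-- The isomorphism `τ_i : R/𝔪_0 ≃ R/𝔪_i`, `r + 𝔪_0 ↦ σ^i(r) + 𝔪_i`. -/
noncomputable def tau (hσ : IsEssential σ) (i : ℕ) : Res (b.m 0) ≃+* Res (b.m i) :=
  RingEquiv.ofBijective (Ideal.quotientMap (b.m i).asIdeal (σ ^ i) (b.below_pow i))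
    ⟨res_injective (b.below_pow i), fun y => by
      obtain ⟨r, rfl⟩ := Ideal.Quotient.mk_surjective y
      obtain ⟨s, hs⟩ := b.surj_pow hσ i r
      exact ⟨Ideal.Quotient.mk _ s, Ideal.Quotient.eq.mpr hs⟩⟩

theorem tau_mk (hσ : IsEssential σ) (i : ℕ) (r : R) :
    b.tau hσ i (Ideal.Quotient.mk _ r) = Ideal.Quotient.mk _ ((σ ^ i) r) := rfl

/-- The residue field `𝕜 = R/𝔪_0`, as a type that carries the action of `ℤ` through `σ̄`. -/
def K (_hσ : IsEssential σ) : Type u := Res (b.m 0)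

variable (hσ : IsEssential σ)

noncomputable instance : CommRing (b.K hσ) := inferInstanceAs (CommRing (Res (b.m 0)))

/-- The reduction map `R → 𝕜`. -/
noncomputable def red : R →+* b.K hσ := Ideal.Quotient.mk (b.m 0).asIdeal

theorem red_surjective : Function.Surjective (b.red hσ) := Ideal.Quotient.mk_surjective

/-- The automorphism `σ̄` of `𝕜 = R/𝔪_0` induced by `τ_k`, `k = d + 1`, using `𝔪_k = 𝔪_0`:
`r + 𝔪_0 ↦ σ^k(r) + 𝔪_0`. -/
noncomputable def sigmaBar : RingAut (b.K hσ) :=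
  (b.tau hσ (b.d + 1)).trans
    (Ideal.quotEquivOfEq (congrArg MaximalSpectrum.asIdeal b.mem_zero_of_period))

theorem sigmaBar_red (r : R) :
    b.sigmaBar hσ (b.red hσ r) = b.red hσ ((σ ^ (b.d + 1)) r) := rfl

/-- `ℤ` acts on `𝕜` by powers of `σ̄`. -/
noncomputable instance : MulSemiringAction (Multiplicative ℤ) (b.K hσ) :=
  MulSemiringAction.compHom (b.K hσ) (zpowersHom (RingAut (b.K hσ)) (b.sigmaBar hσ))

theorem ofAdd_one_smul (z : b.K hσ) :
    (Multiplicative.ofAdd (1 : ℤ)) • z = b.sigmaBar hσ z := by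
  change (zpowersHom (RingAut (b.K hσ)) (b.sigmaBar hσ) (Multiplicative.ofAdd 1)) z = _
  simp [zpowersHom_apply]

/-- The skew Laurent polynomial ring `𝐏 = 𝕜[α, α⁻¹; σ̄]`, with `α c = σ̄(c) α` for `c ∈ 𝕜`. -/
abbrev P : Type u := SkewMonoidAlgebra (b.K hσ) (Multiplicative ℤ)

/-- The embedding `𝕜 → 𝐏`. -/
noncomputable def const : b.K hσ →+* b.P hσ := SkewMonoidAlgebra.singleOneRingHom

/-- The unit `α` of `𝐏`. -/
noncomputable def alpha : (b.P hσ)ˣ where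
  val := SkewMonoidAlgebra.single (Multiplicative.ofAdd 1) 1
  inv := SkewMonoidAlgebra.single (Multiplicative.ofAdd (-1)) 1
  val_inv := by
    rw [SkewMonoidAlgebra.single_mul_single, ← ofAdd_add, SkewMonoidAlgebra.one_def]; simp
  inv_val := by
    rw [SkewMonoidAlgebra.single_mul_single, ← ofAdd_add, SkewMonoidAlgebra.one_def]; simp

theorem alpha_mul_const (c : b.K hσ) :
    (b.alpha hσ : b.P hσ) * b.const hσ c = b.const hσ (b.sigmaBar hσ c) * b.alpha hσ := by
  change SkewMonoidAlgebra.single (Multiplicative.ofAdd (1 : ℤ)) (1 : b.K hσ) *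
      SkewMonoidAlgebra.single 1 c =
    SkewMonoidAlgebra.single 1 (b.sigmaBar hσ c) *
      SkewMonoidAlgebra.single (Multiplicative.ofAdd (1 : ℤ)) 1
  rw [SkewMonoidAlgebra.single_mul_single, SkewMonoidAlgebra.single_mul_single,
    ofAdd_one_smul]
  simp

theorem const_mul_alpha_inv (c : b.K hσ) :
    b.const hσ c * ((b.alpha hσ)⁻¹ : (b.P hσ)ˣ) =
      ((b.alpha hσ)⁻¹ : (b.P hσ)ˣ) * b.const hσ (b.sigmaBar hσ c) := by
  rw [Units.mul_inv_eq_iff_eq_mul, mul_assoc, ← alpha_mul_const, Units.inv_mul_cancel_left]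

/-- The left `𝐏`-module `L_f = 𝐏 / 𝐏f`. -/
abbrev L (f : b.P hσ) : Type u := b.P hσ ⧸ Submodule.span (b.P hσ) {f}

end BandSeq

section Shift

variable {P : Type u} [Ring P] {L : Type u} [AddCommGroup L] [Module P L]

/-- The cyclic shift `v ↦ (a v_d, v_0, …, v_{d-1})` of `L^{d+1}`, twisted by a unit `a`. -/
def shift (d : ℕ) (a : Pˣ) : (Fin (d + 1) → L) ≃+ (Fin (d + 1) → L) where
  toFun v := Fin.cons (α := fun _ => L) ((a : P) • v (Fin.last d)) (fun i : Fin d => v i.castSucc)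
  invFun w := Fin.snoc (α := fun _ => L) (fun i : Fin d => w i.succ) (((a⁻¹ : Pˣ) : P) • w 0)
  left_inv v := by
    ext i; refine Fin.lastCases ?_ (fun i => ?_) i
    · simp [smul_smul]
    · simp
  right_inv w := by
    ext i; refine Fin.cases ?_ (fun i => ?_) i
    · simp [smul_smul]
    · simp
  map_add' v w := by
    ext i; refine Fin.cases ?_ (fun i => ?_) i <;> simp

/-- `R` acting on `⊕_i L`, on the `i`-th copy through the ring homomorphism `c i : R → P`. -/
def twist {ι : Type} (c : ι → R →+* P) : R →+* AddMonoid.End (ι → L) where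
  toFun r := AddMonoidHom.mk' (fun v i => c i r • v i) (fun v w => by ext i; simp)
  map_one' := AddMonoidHom.ext fun v => funext fun i => by
    change c i 1 • v i = v i
    rw [map_one, one_smul]
  map_mul' r s := AddMonoidHom.ext fun v => funext fun i => by
    change c i (r * s) • v i = c i r • c i s • v i
    rw [map_mul, mul_smul]
  map_zero' := AddMonoidHom.ext fun v => funext fun i => by
    change c i 0 • v i = 0
    rw [map_zero, zero_smul]
  map_add' r s := AddMonoidHom.ext fun v => funext fun i => by
    change c i (r + s) • v i = c i r • v i + c i s • v i
    rw [map_add, add_smul]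

theorem twist_apply {ι : Type} (c : ι → R →+* P) (r : R) (v : ι → L) (i : ι) :
    twist c r v i = c i r • v i := rfl

theorem shift_zero (d : ℕ) (a : Pˣ) (v : Fin (d + 1) → L) :
    shift d a v 0 = (a : P) • v (Fin.last d) := rfl

theorem shift_succ (d : ℕ) (a : Pˣ) (v : Fin (d + 1) → L) (i : Fin d) :
    shift d a v i.succ = v i.castSucc := rfl

end Shift

section Band

variable {σ : R →+* R} (hσ : IsEssential σ) (t : R) (b : BandSeq σ) (f : b.P hσ)

/-- On the copy of `L_f` of weight `𝔪_{-i}`, `r ∈ R` acts through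
`r + 𝔪_{-i} ↦ σ^i(r) + 𝔪_0`. -/
noncomputable def bandCoefM (i : Fin (b.d + 1)) : R →+* b.P hσ :=
  (b.const hσ).comp ((b.red hσ).comp (σ ^ (i : ℕ)))

/-- On the copy of `L_f` of weight `𝔪_i`, `r ∈ R` acts through `τ_i⁻¹(r + 𝔪_i) ∈ R/𝔪_0`. -/
noncomputable def bandCoefN (i : Fin (b.d + 1)) : R →+* b.P hσ :=
  (b.const hσ).comp
    (((b.tau hσ i).symm : Res (b.m (i : ℕ)) →+* Res (b.m 0)).comp
      (Ideal.Quotient.mk (b.m (i : ℕ)).asIdeal))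

/-- The underlying group `⊕_{i=0}^{k-1} L_f` of `M^f`; the `i`-th copy has weight `𝔪_{-i}`. -/
def BandM {σ : R →+* R} (hσ : IsEssential σ) (_t : R) (b : BandSeq σ) (f : b.P hσ) : Type u :=
  Fin (b.d + 1) → b.L hσ f

/-- The underlying group `⊕_{i=0}^{k-1} L_f` of `N^f`; the `i`-th copy has weight `𝔪_i`. -/
def BandN {σ : R →+* R} (hσ : IsEssential σ) (_t : R) (b : BandSeq σ) (f : b.P hσ) : Type u :=
  Fin (b.d + 1) → b.L hσ f

noncomputable instance : AddCommGroup (BandM hσ t b f) :=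
  inferInstanceAs (AddCommGroup (Fin (b.d + 1) → b.L hσ f))

noncomputable instance : AddCommGroup (BandN hσ t b f) :=
  inferInstanceAs (AddCommGroup (Fin (b.d + 1) → b.L hσ f))

theorem bandCoefN_pow (i : Fin (b.d + 1)) (s : R) :
    bandCoefN hσ b i ((σ ^ (i : ℕ)) s) = b.const hσ (b.red hσ s) := by
  change b.const hσ ((b.tau hσ i).symm (Ideal.Quotient.mk _ ((σ ^ (i : ℕ)) s))) = _
  rw [← b.tau_mk hσ, RingEquiv.symm_apply_apply]
  rfl

theorem bandCoefN_congr (i : Fin (b.d + 1)) {r s : R} (h : r - s ∈ (b.m (i : ℕ)).asIdeal) :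
    bandCoefN hσ b i r = bandCoefN hσ b i s := by
  change b.const hσ ((b.tau hσ i).symm (Ideal.Quotient.mk _ r)) =
    b.const hσ ((b.tau hσ i).symm (Ideal.Quotient.mk _ s))
  rw [Ideal.Quotient.eq.mpr h]

/-- `Y` is the identity from the `i`-th to the `(i+1)`-st copy and acts as `α⁻¹` from the last
copy to the `0`-th; `X` is given by `X(Yv) = σ(t)v`. -/
noncomputable def bandRepM : Rep σ t (Fin (b.d + 1) → b.L hσ f) :=
  Rep.ofY σ t (twist (bandCoefM hσ b)) (shift b.d (b.alpha hσ)⁻¹) (by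
    intro r v
    ext i
    refine Fin.cases ?_ (fun i => ?_) i
    · rw [twist_apply, shift_zero, shift_zero, twist_apply, smul_smul, smul_smul]
      congr 1
      change b.const hσ (b.red hσ r) * _ = _ * b.const hσ (b.red hσ ((σ ^ b.d) (σ r)))
      rw [b.const_mul_alpha_inv, b.sigmaBar_red, pow_succ]
      rfl
    · rw [twist_apply, shift_succ, shift_succ, twist_apply]
      congr 1)

/-- `X` is the identity from the `i`-th to the `(i+1)`-st copy and acts as `α` from the last
copy to the `0`-th; `Y` is given by `Y(Xv) = tv`. -/
noncomputable def bandRepN : Rep σ t (Fin (b.d + 1) → b.L hσ f) :=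
  Rep.ofX σ t (twist (bandCoefN hσ b)) (shift b.d (b.alpha hσ)) (by
    intro r v
    ext i
    refine Fin.cases ?_ (fun i => ?_) i
    · obtain ⟨s, hs⟩ := b.surj_pow hσ b.d r
      rw [twist_apply, shift_zero, shift_zero, twist_apply, smul_smul, smul_smul]
      congr 1
      have h1 : r - (σ ^ ((Fin.last b.d : Fin (b.d + 1)) : ℕ)) s ∈
          (b.m ((Fin.last b.d : Fin (b.d + 1)) : ℕ)).asIdeal := by
        rw [← neg_sub]
        exact neg_mem hs
      have h2 : σ r - (σ ^ (b.d + 1)) s ∈ (b.m ((0 : Fin (b.d + 1)) : ℕ)).asIdeal := by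
        have h3 := b.chain b.d (neg_mem hs)
        have h4 : b.m ((b.d : ℤ) + 1) = b.m 0 := by simpa using b.mem_zero_of_period
        rw [h4] at h3
        simpa [pow_succ', Ideal.mem_comap] using h3
      rw [bandCoefN_congr hσ b _ h1, bandCoefN_pow, b.alpha_mul_const,
        bandCoefN_congr hσ b _ h2, b.sigmaBar_red]
      congr 1
      exact (bandCoefN_pow hσ b 0 ((σ ^ (b.d + 1)) s)).symm
    · obtain ⟨s, hs⟩ := b.surj_pow hσ i r
      rw [twist_apply, shift_succ, shift_succ, twist_apply]
      congr 1
      have h1 : r - (σ ^ ((i.castSucc : Fin (b.d + 1)) : ℕ)) s ∈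
          (b.m ((i.castSucc : Fin (b.d + 1)) : ℕ)).asIdeal := by
        rw [← neg_sub]
        exact neg_mem hs
      have h2 : σ r - (σ ^ ((i.succ : Fin (b.d + 1)) : ℕ)) s ∈
          (b.m ((i.succ : Fin (b.d + 1)) : ℕ)).asIdeal := by
        have h3 := b.chain i (neg_mem hs)
        simpa [pow_succ', Ideal.mem_comap] using h3
      rw [bandCoefN_congr hσ b _ h1, bandCoefN_pow, bandCoefN_congr hσ b _ h2, bandCoefN_pow])

/-- The band module `M^f`. -/
noncomputable instance : Module (WGWA σ t) (BandM hσ t b f) := (bandRepM hσ t b f).module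

/-- The band module `N^f`. -/
noncomputable instance : Module (WGWA σ t) (BandN hσ t b f) := (bandRepN hσ t b f).module

end Band

/-! ### The two families -/

/-- `V` is (isomorphic to) a bounded string module. -/
def IsBoundedString {σ : R →+* R} (hσ : IsEssential σ) (t : R) (V : Type v) [AddCommGroup V]
    [Module (WGWA σ t) V] : Prop :=
  ∃ (n : ℕ) (s : BoundedSeq σ t n), Nonempty (V ≃ₗ[WGWA σ t] BoundedString hσ s)

/-- `V` is (isomorphic to) a band module `M^f` or `N^f`, with `f ∈ 𝐏` irreducible. -/
def IsBand {σ : R →+* R} (hσ : IsEssential σ) (t : R) (V : Type v) [AddCommGroup V]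
    [Module (WGWA σ t) V] : Prop :=
  ∃ (b : BandSeq σ) (f : b.P hσ), Irreducible f ∧
    (Nonempty (V ≃ₗ[WGWA σ t] BandM hσ t b f) ∨ Nonempty (V ≃ₗ[WGWA σ t] BandN hσ t b f))

end WGWA

end Algebra

/-!
Let `V` be a simple `A`-module of finite length over `R`. The relations make `X` a `σ`-semilinear
operator and give `r Y = Y σ(r)`, so that `Y` takes vectors of weight `𝔪` to vectors of weight
`σ⁻¹(𝔪)`, which is again maximal as `σ` is essential.

Essentiality also implies that restriction of scalars along `σ` preserves length
(`length_eq_of_essential`). Hence `X`, once injective, is surjective, and `Y`, once surjective, is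
injective, although neither is `R`-linear. This leaves three cases.

* `X` is not injective. Its kernel is an `R`-submodule and contains a weight vector `u ≠ 0`, and `V`
  is the `R`-span of `u, Yu, Y²u, …`. If `u` is not in the span of `Yu, Y²u, …`, then `σ(t)`
  kills some `Yᴺu`. The first such `N` satisfies `Yᴺ⁺¹u = 0` as well, and `Yᴺu, …, Yu, u` present
  `V` as a bounded string module (`isBoundedString_of_X_smul_eq_zero`).
* `X` is not injective and `u` is in the span of `Yu, Y²u, …`. Then `Y` is surjective
  (`opY_surjective`), hence bijective. Put `y = Y`.
* `X` is bijective. Put `y = X⁻¹`.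

In the last two cases `y` is a bijection with `r y = y σ(r)`. Were the weights of the vectors `yⁿ w`
all different for some weight vector `w ≠ 0`, these vectors would span an infinite descending chain
of submodules; so some weight `𝔪_0` is periodic under `𝔪 ↦ σ⁻¹(𝔪)`, with minimal period `k` say
(`exists_periodic_weight`, `exists_bandSeq`). On the finite-dimensional weight space of `𝔪_0`, the
ring `𝐏` acts with `α` acting as `y⁻ᵏ`. A simple `𝐏`-submodule is `𝐏 / J` with `J` a maximal left
ideal, nonzero because `𝐏` is infinite-dimensional over `𝕜`. By Euclidean division `J = 𝐏f`, and `f`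
is irreducible (`SkewLaurent.exists_irreducible_smul_eq_zero`). The inclusion of this copy of `L_f`
extends to a nonzero homomorphism from `M^f` or `N^f` to `V` (`exists_linearMap_bandM`,
`exists_linearMap_bandN`), which is an isomorphism because the band modules are simple too: a
submodule is the sum of its weight components, and its component in the `0`-th copy of `L_f` is
stable under `𝐏` (`eq_top_of_shift_stable`).

Conversely, both families consist of modules spanned over `R` by finitely many weight vectors, and
any such module is a weight module of finite length (`isWeight_and_finiteLength`).

In the lemmas where `V` is both an `R`-module and an `A`-module, the hypothesis `hc` says that `R`
acts through `R → A`.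
-/

/-! ### Skew Laurent polynomials over a division ring -/

namespace SkewLaurent

open SkewMonoidAlgebra Multiplicative

variable {K : Type u} [Ring K]

/-- `p` has all its exponents in the window `[a, a + n)`. -/
def SupportedOn (p : SkewMonoidAlgebra K (Multiplicative ℤ)) (a : ℤ) (n : ℕ) : Prop :=
  ∀ i, p.coeff i ≠ 0 → a ≤ i.toAdd ∧ i.toAdd < a + n

theorem exists_supportedOn (p : SkewMonoidAlgebra K (Multiplicative ℤ)) :
    ∃ a n, SupportedOn p a n := by
  obtain ⟨a, ha⟩ := (p.support.image toAdd).bddBelow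
  obtain ⟨b, hb⟩ := (p.support.image toAdd).bddAbove
  refine ⟨a, (b - a + 1).toNat, fun i hi => ?_⟩
  have hi' : toAdd i ∈ p.support.image toAdd :=
    Finset.mem_image_of_mem _ (mem_support_iff.mpr hi)
  have h1 := ha hi'
  have h2 := hb hi'
  omega

theorem SupportedOn.sub {p q : SkewMonoidAlgebra K (Multiplicative ℤ)} {a : ℤ} {n : ℕ}
    (hp : SupportedOn p a n) (hq : SupportedOn q a n) : SupportedOn (p - q) a n := by
  intro i hi
  by_cases h : p.coeff i = 0
  · exact hq i (fun h' => hi (by simp [h, h']))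
  · exact hp i h

theorem SupportedOn.mono {p : SkewMonoidAlgebra K (Multiplicative ℤ)} {a b : ℤ} {m n : ℕ}
    (hp : SupportedOn p a m) (h1 : b ≤ a) (h2 : a + m ≤ b + n) : SupportedOn p b n := by
  intro i hi
  have := hp i hi
  omega

/-- A nonzero `f` has an exact window: both extreme coefficients are nonzero. -/
theorem exists_exact_window {f : SkewMonoidAlgebra K (Multiplicative ℤ)} (hf : f ≠ 0) :
    ∃ (a : ℤ) (w : ℕ), SupportedOn f a (w + 1) ∧ f.coeff (ofAdd a) ≠ 0 ∧
      f.coeff (ofAdd (a + w)) ≠ 0 := by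
  have hs : (f.support.image toAdd).Nonempty := by
    rw [Finset.image_nonempty, Finset.nonempty_iff_ne_empty]
    exact fun h => hf (support_eq_empty.mp h)
  obtain ⟨i, hi, hi'⟩ := Finset.mem_image.mp (Finset.min'_mem _ hs)
  obtain ⟨j, hj, hj'⟩ := Finset.mem_image.mp (Finset.max'_mem _ hs)
  have hle : toAdd i ≤ toAdd j := by
    rw [hi', hj']
    exact Finset.min'_le_max' _ hs
  refine ⟨toAdd i, (toAdd j - toAdd i).toNat, fun k hk => ?_, mem_support_iff.mp hi, ?_⟩
  · have hk' : toAdd k ∈ f.support.image toAdd :=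
      Finset.mem_image_of_mem _ (mem_support_iff.mpr hk)
    have h1 := Finset.min'_le _ _ hk'
    have h2 := Finset.le_max' _ _ hk'
    omega
  · have : toAdd i + ((toAdd j - toAdd i).toNat : ℤ) = toAdd j := by omega
    rw [this]
    exact mem_support_iff.mp hj

variable [MulSemiringAction (Multiplicative ℤ) K]

/-- Multiplication by a power of the variable moves the window. -/
theorem SupportedOn.single_mul {p : SkewMonoidAlgebra K (Multiplicative ℤ)} {a : ℤ} {n : ℕ}
    (h : SupportedOn p a n) (s : ℤ) (c : K) : SupportedOn (single (ofAdd s) c * p) (a + s) n := by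
  intro i hi
  rw [coeff_single_mul] at hi
  have h1 := h ((ofAdd s)⁻¹ * i) (fun h0 => hi (by rw [h0, smul_zero, mul_zero]))
  simp only [toAdd_mul, toAdd_inv, toAdd_ofAdd] at h1
  omega

/-- Cancel the coefficient of `p` at the exponent `s + e` against the coefficient of `f` at `e`. -/
theorem exists_coeff_sub_eq_zero (hK : ∀ c : K, c ≠ 0 → IsUnit c)
    (f p : SkewMonoidAlgebra K (Multiplicative ℤ)) (e s : ℤ) (hf : f.coeff (ofAdd e) ≠ 0) :
    ∃ c, (p - single (ofAdd s) c * f).coeff (ofAdd (s + e)) = 0 := by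
  obtain ⟨u, hu⟩ := hK _ hf
  refine ⟨p.coeff (ofAdd (s + e)) * (ofAdd s • (↑u⁻¹ : K)), ?_⟩
  have h : (ofAdd s)⁻¹ * ofAdd (s + e) = ofAdd e := by
    rw [ofAdd_add, inv_mul_cancel_left]
  rw [coeff_sub, Finsupp.sub_apply, coeff_single_mul, h, ← hu, mul_assoc, ← smul_mul',
    Units.inv_mul, smul_one, mul_one, sub_self]

/-- One step of the Euclidean division from the top. -/
theorem exists_supportedOn_pred (hK : ∀ c : K, c ≠ 0 → IsUnit c)
    {f p : SkewMonoidAlgebra K (Multiplicative ℤ)} {a b : ℤ} {w n : ℕ}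
    (hf : SupportedOn f a (w + 1)) (hw : f.coeff (ofAdd (a + w)) ≠ 0)
    (hp : SupportedOn p b (n + 1)) (hn : w ≤ n) : ∃ q, SupportedOn (p - q * f) b n := by
  obtain ⟨c, hc⟩ := exists_coeff_sub_eq_zero hK f p (a + w) (b + n - (a + w)) hw
  refine ⟨single (ofAdd (b + n - (a + w))) c, fun i hi => ?_⟩
  have h1 := hp.sub ((hf.single_mul (b + n - (a + w)) c).mono (b := b) (n := n + 1)
    (by omega) (by push_cast; omega)) i hi
  have h2 : toAdd i ≠ b + n := by
    intro h
    refine hi ?_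
    rw [← ofAdd_toAdd i, h]
    convert hc using 3
    omega
  push_cast at h1
  omega

/-- One step of the Euclidean division from the bottom. -/
theorem exists_supportedOn_succ (hK : ∀ c : K, c ≠ 0 → IsUnit c)
    {f p : SkewMonoidAlgebra K (Multiplicative ℤ)} {a b : ℤ} {w n : ℕ}
    (hf : SupportedOn f a (w + 1)) (ha : f.coeff (ofAdd a) ≠ 0)
    (hp : SupportedOn p b (n + 1)) (hn : w ≤ n) : ∃ q, SupportedOn (p - q * f) (b + 1) n := by
  obtain ⟨c, hc⟩ := exists_coeff_sub_eq_zero hK f p a (b - a) ha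
  refine ⟨single (ofAdd (b - a)) c, fun i hi => ?_⟩
  have h1 := hp.sub ((hf.single_mul (b - a) c).mono (b := b) (n := n + 1)
    (by omega) (by push_cast; omega)) i hi
  have h2 : toAdd i ≠ b := by
    intro h
    refine hi ?_
    rw [← ofAdd_toAdd i, h]
    convert hc using 3
    omega
  push_cast at h1
  omega

/-- Any window can be cut down from the top to the width of the divisor `f`. -/
theorem exists_supportedOn_top (hK : ∀ c : K, c ≠ 0 → IsUnit c)
    {f : SkewMonoidAlgebra K (Multiplicative ℤ)} {a : ℤ} {w : ℕ}
    (hf : SupportedOn f a (w + 1)) (hw : f.coeff (ofAdd (a + w)) ≠ 0) (n : ℕ)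
    (p : SkewMonoidAlgebra K (Multiplicative ℤ)) (b : ℤ) (hp : SupportedOn p b (w + n)) :
    ∃ q, SupportedOn (p - q * f) b w := by
  induction n generalizing p with
  | zero => exact ⟨0, by simpa using hp⟩
  | succ n ih =>
    obtain ⟨q, hq⟩ := exists_supportedOn_pred hK hf hw (n := w + n) hp (by omega)
    obtain ⟨q', hq'⟩ := ih _ hq
    exact ⟨q + q', by rwa [add_mul, ← sub_sub]⟩

/-- Any window can be cut down from the bottom to the width of the divisor `f`. -/
theorem exists_supportedOn_bot (hK : ∀ c : K, c ≠ 0 → IsUnit c)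
    {f : SkewMonoidAlgebra K (Multiplicative ℤ)} {a : ℤ} {w : ℕ}
    (hf : SupportedOn f a (w + 1)) (ha : f.coeff (ofAdd a) ≠ 0) (n : ℕ)
    (p : SkewMonoidAlgebra K (Multiplicative ℤ)) (b : ℤ) (hp : SupportedOn p b (w + n)) :
    ∃ q, SupportedOn (p - q * f) (b + n) w := by
  induction n generalizing p b with
  | zero => exact ⟨0, by simpa using hp⟩
  | succ n ih =>
    obtain ⟨q, hq⟩ := exists_supportedOn_succ hK hf ha (n := w + n) hp (by omega)
    obtain ⟨q', hq'⟩ := ih _ _ hq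
    refine ⟨q + q', ?_⟩
    rw [add_mul, ← sub_sub]
    push_cast
    convert hq' using 1
    ring

/-- Modulo `f ≠ 0` every skew Laurent polynomial is congruent to one of bounded degree. -/
theorem exists_remainder (hK : ∀ c : K, c ≠ 0 → IsUnit c)
    {f : SkewMonoidAlgebra K (Multiplicative ℤ)} (hf : f ≠ 0) :
    ∃ w : ℕ, ∀ p, ∃ q, SupportedOn (p - q * f) 0 w := by
  obtain ⟨a, w, h, ha, hw⟩ := exists_exact_window hf
  refine ⟨w, fun p => ?_⟩
  obtain ⟨b, n, hp⟩ := exists_supportedOn p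
  -- Enlarge the window of `p` to `[-k, k + w)`, then clear it from both ends.
  obtain ⟨k, hk1, hk2⟩ : ∃ k : ℕ, -(k : ℤ) ≤ b ∧ b + n ≤ k :=
    ⟨(max (-b) (b + n)).toNat, by omega, by omega⟩
  obtain ⟨q, hq⟩ := exists_supportedOn_top hK h hw (2 * k) p (-(k : ℤ))
    (hp.mono hk1 (by push_cast; omega))
  obtain ⟨q', hq'⟩ := exists_supportedOn_bot hK h ha k _ (-(k : ℤ))
    (hq.mono (n := w + k) le_rfl (by push_cast; omega))
  exact ⟨q + q', by rw [add_mul, ← sub_sub]; simpa using hq'⟩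

/-- The ring of skew Laurent polynomials over a division ring is a principal left ideal ring. -/
theorem exists_eq_span_singleton (hK : ∀ c : K, c ≠ 0 → IsUnit c)
    (J : Submodule (SkewMonoidAlgebra K (Multiplicative ℤ))
      (SkewMonoidAlgebra K (Multiplicative ℤ))) :
    ∃ g, J = Submodule.span _ {g} := by
  classical
  by_cases hJ : J = ⊥
  · exact ⟨0, by simp [hJ]⟩
  have hex : ∃ n : ℕ, ∃ g ∈ J, g ≠ 0 ∧ ∃ a, SupportedOn g a n := by
    obtain ⟨g, hg, hg0⟩ := J.ne_bot_iff.mp hJ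
    obtain ⟨a, n, h⟩ := exists_supportedOn g
    exact ⟨n, g, hg, hg0, a, h⟩
  -- A generator is an element of smallest support width.
  obtain ⟨g, hg, hg0, a, ha⟩ := Nat.find_spec hex
  obtain ⟨a', w, h, h1, h2⟩ := exists_exact_window hg0
  have hw : w + 1 ≤ Nat.find hex := by
    have := ha _ h1
    have := ha _ h2
    simp only [toAdd_ofAdd] at *
    omega
  refine ⟨g, le_antisymm (fun p hp => ?_) ?_⟩
  · obtain ⟨b, n, hb⟩ := exists_supportedOn p
    obtain ⟨q, hq⟩ := exists_supportedOn_top hK h h2 n p b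
      (hb.mono le_rfl (by push_cast; omega))
    have hmem : p - q * g ∈ J := J.sub_mem hp (J.smul_mem q hg)
    have h0 : p - q * g = 0 := by
      by_contra hne
      have := Nat.find_min' hex ⟨_, hmem, hne, b, hq⟩
      omega
    exact Submodule.mem_span_singleton.mpr ⟨q, (sub_eq_zero.mp h0).symm⟩
  · rwa [Submodule.span_singleton_le_iff_mem]

/-- `Multiplicative ℤ` has unique products, and these carry over to the twisted coefficients. -/
theorem noZeroDivisors [NoZeroDivisors K] :
    NoZeroDivisors (SkewMonoidAlgebra K (Multiplicative ℤ)) where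
  eq_zero_or_eq_zero_of_mul_eq_zero {f g} hfg := by
    by_contra! hne
    have hf : f.support.Nonempty := by
      rw [Finset.nonempty_iff_ne_empty]
      exact fun h => hne.1 (support_eq_empty.mp h)
    have hg : g.support.Nonempty := by
      rw [Finset.nonempty_iff_ne_empty]
      exact fun h => hne.2 (support_eq_empty.mp h)
    obtain ⟨a, ha, b, hb, hu⟩ := UniqueProds.uniqueMul_of_nonempty hf hg
    have h : (f * g).coeff (a * b) = f.coeff a * a • g.coeff b := by
      rw [coeff_mul, sum_def', Finset.sum_eq_single a, sum_def', Finset.sum_eq_single b, if_pos rfl]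
      · intro c hc hcb
        exact if_neg fun h => hcb (hu ha hc h).2
      · exact fun h => absurd hb h
      · intro c hc hca
        exact Finset.sum_eq_zero fun d hd => if_neg fun h => hca (hu hc hd h).1
      · exact fun h => absurd ha h
    rw [hfg] at h
    have h' : f.coeff a * a • g.coeff b = 0 := by rw [← h]; rfl
    rcases mul_eq_zero.mp h' with h0 | h0
    · exact mem_support_iff.mp ha h0
    · exact mem_support_iff.mp hb ((smul_eq_zero_iff_eq a).mp h0)

variable [NoZeroDivisors K] [Nontrivial K]

theorem isUnit_of_mul_eq_one_left {a c : SkewMonoidAlgebra K (Multiplicative ℤ)}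
    (h : c * a = 1) : IsUnit a ∧ IsUnit c := by
  have := noZeroDivisors (K := K)
  have h' : a * c = 1 := by
    have ha : a ≠ 0 := by rintro rfl; simp at h
    have h0 : (a * c - 1) * a = 0 := by rw [sub_mul, mul_assoc, h]; simp
    exact sub_eq_zero.mp ((mul_eq_zero.mp h0).resolve_right ha)
  exact ⟨⟨⟨a, c, h', h⟩, rfl⟩, ⟨⟨c, a, h, h'⟩, rfl⟩⟩

/-- An irreducible skew Laurent polynomial generates a maximal left ideal, since all left ideals are
principal. -/
theorem isSimpleModule_quotient (hK : ∀ c : K, c ≠ 0 → IsUnit c)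
    {f : SkewMonoidAlgebra K (Multiplicative ℤ)} (hf : Irreducible f) :
    IsSimpleModule (SkewMonoidAlgebra K (Multiplicative ℤ))
      (SkewMonoidAlgebra K (Multiplicative ℤ) ⧸
        Submodule.span (SkewMonoidAlgebra K (Multiplicative ℤ)) {f}) := by
  rw [isSimpleModule_iff_isCoatom]
  refine ⟨fun h => hf.not_isUnit ?_, fun J hJ => ?_⟩
  · have h1 : (1 : SkewMonoidAlgebra K (Multiplicative ℤ)) ∈
        Submodule.span (SkewMonoidAlgebra K (Multiplicative ℤ)) {f} := by rw [h]; trivial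
    obtain ⟨c, hc⟩ := Submodule.mem_span_singleton.mp h1
    exact (isUnit_of_mul_eq_one_left hc).1
  · obtain ⟨g, rfl⟩ := exists_eq_span_singleton hK J
    obtain ⟨a, ha⟩ := Submodule.mem_span_singleton.mp
      (hJ.le (Submodule.mem_span_singleton_self f))
    rcases hf.isUnit_or_isUnit ha.symm with ⟨u, rfl⟩ | ⟨u, rfl⟩
    · refine absurd ?_ hJ.not_ge
      rw [Submodule.span_singleton_le_iff_mem, Submodule.mem_span_singleton]
      exact ⟨(↑u⁻¹ : SkewMonoidAlgebra K (Multiplicative ℤ)), by rw [← ha]; simp⟩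
    · rw [eq_top_iff]
      intro p _
      exact Submodule.mem_span_singleton.mpr ⟨p * ↑u⁻¹, by simp⟩

/-- A generator of a nonzero maximal left ideal is irreducible. -/
theorem irreducible_of_isCoatom {f : SkewMonoidAlgebra K (Multiplicative ℤ)} (hf : f ≠ 0)
    (h : IsCoatom (Submodule.span (SkewMonoidAlgebra K (Multiplicative ℤ)) {f})) :
    Irreducible f := by
  have := noZeroDivisors (K := K)
  refine ⟨fun hu => h.1 ?_, fun a b hab => ?_⟩
  · obtain ⟨u, rfl⟩ := hu
    rw [eq_top_iff]
    intro p _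
    exact Submodule.mem_span_singleton.mpr ⟨p * (↑u⁻¹), by simp⟩
  · have hle : Submodule.span (SkewMonoidAlgebra K (Multiplicative ℤ)) {f} ≤
        Submodule.span (SkewMonoidAlgebra K (Multiplicative ℤ)) {b} := by
      rw [Submodule.span_singleton_le_iff_mem]
      exact Submodule.mem_span_singleton.mpr ⟨a, hab.symm⟩
    rcases h.le_iff.mp hle with h1 | h1
    · have h2 : (1 : SkewMonoidAlgebra K (Multiplicative ℤ)) ∈ Submodule.span
          (SkewMonoidAlgebra K (Multiplicative ℤ)) {b} := by rw [h1]; trivial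
      obtain ⟨c, hc⟩ := Submodule.mem_span_singleton.mp h2
      exact Or.inr (isUnit_of_mul_eq_one_left hc).1
    · have h2 : b ∈ Submodule.span (SkewMonoidAlgebra K (Multiplicative ℤ)) {f} := by
        rw [← h1]; exact Submodule.mem_span_singleton_self b
      obtain ⟨c, hc⟩ := Submodule.mem_span_singleton.mp h2
      have hb : b ≠ 0 := by rintro rfl; simp at hab; exact hf hab
      have h3 : (c * a - 1) * b = 0 := by
        rw [sub_mul, mul_assoc, ← hab]
        simpa [sub_eq_zero] using hc
      exact Or.inl (isUnit_of_mul_eq_one_left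
        (sub_eq_zero.mp ((mul_eq_zero.mp h3).resolve_right hb))).1

/-- A nonzero module of finite length over the coefficients contains a nonzero element killed by an
irreducible skew Laurent polynomial. -/
theorem exists_irreducible_smul_eq_zero (hK : ∀ c : K, c ≠ 0 → IsUnit c) {L : Type v}
    [AddCommGroup L] [Module (SkewMonoidAlgebra K (Multiplicative ℤ)) L] [Module K L]
    (hL : ∀ (c : K) (x : L), (single 1 c : SkewMonoidAlgebra K (Multiplicative ℤ)) • x = c • x)
    [IsNoetherian K L] [IsArtinian K L] [Nontrivial L] :
    ∃ f : SkewMonoidAlgebra K (Multiplicative ℤ), Irreducible f ∧ ∃ l : L, l ≠ 0 ∧ f • l = 0 := by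
  have hcm : ∀ (c : K) (p : SkewMonoidAlgebra K (Multiplicative ℤ)), c • p = single 1 c * p :=
    fun c p => by ext i; simp
  have : IsScalarTower K (SkewMonoidAlgebra K (Multiplicative ℤ)) L :=
    ⟨fun c p x => by rw [hcm, mul_smul, hL]⟩
  have : IsArtinian (SkewMonoidAlgebra K (Multiplicative ℤ)) L := isArtinian_of_tower K ‹_›
  obtain ⟨S, hS⟩ := IsAtomic.exists_atom (Submodule (SkewMonoidAlgebra K (Multiplicative ℤ)) L)
  obtain ⟨l, hl, hl0⟩ := S.ne_bot_iff.mp hS.1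
  have hS' := isSimpleModule_iff_isAtom.mpr hS
  let φ := LinearMap.toSpanSingleton (SkewMonoidAlgebra K (Multiplicative ℤ)) S ⟨l, hl⟩
  have hφ : φ ≠ 0 := by
    intro h
    have := congrArg Subtype.val (LinearMap.congr_fun h 1)
    simp [φ] at this
    exact hl0 this
  have hmax : IsCoatom (LinearMap.ker φ) := by
    rw [← isSimpleModule_iff_isCoatom]
    exact IsSimpleModule.congr (φ.quotKerEquivOfSurjective (LinearMap.surjective_of_ne_zero hφ))
  obtain ⟨f, hf⟩ := exists_eq_span_singleton hK (LinearMap.ker φ)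
  have hfl : f • l = 0 := by
    have : f ∈ LinearMap.ker φ := by rw [hf]; exact Submodule.mem_span_singleton_self f
    exact congrArg Subtype.val this
  refine ⟨f, irreducible_of_isCoatom ?_ (hf ▸ hmax), l, hl0, hfl⟩
  -- Were `f = 0`, the powers of the variable applied to `l` would be independent over `K`.
  rintro rfl
  let ψ : SkewMonoidAlgebra K (Multiplicative ℤ) →ₗ[K] L :=
    (LinearMap.toSpanSingleton (SkewMonoidAlgebra K (Multiplicative ℤ)) L l).restrictScalars K
  have hψ : LinearMap.ker ψ = ⊥ := by
    rw [eq_bot_iff]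
    intro p hp
    have : p ∈ LinearMap.ker φ := Subtype.ext hp
    rw [hf] at this
    simpa using this
  have hli := (basisSingleOne (k := K) (G := Multiplicative ℤ)).linearIndependent.map' ψ hψ
  have := hli.finite_of_isNoetherian
  exact not_finite (Multiplicative ℤ)

end SkewLaurent

/-! ### Length along an essential ring homomorphism -/

section Length

variable {R S V W : Type*} [CommRing R] [CommRing S] [AddCommGroup V] [AddCommGroup W] [Module S V]

/-- If `R → S / 𝔪` is onto for every maximal ideal `𝔪` of `S`, restricting scalars from `S` to `R`
preserves the length of modules of finite length: the simple `S`-modules `S / 𝔪` stay simple. -/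
theorem length_eq_of_essential [Algebra R S]
    (hess : ∀ m : Ideal S, m.IsMaximal → ∀ s : S, ∃ r : R, algebraMap R S r - s ∈ m)
    (h : IsFiniteLength S V) :
    ∀ [Module R V] [IsScalarTower R S V], Module.length R V = Module.length S V := by
  induction h with
  | of_subsingleton => intros; rw [Module.length_eq_zero, Module.length_eq_zero]
  | @of_simple_quotient V _ _ N hN _ ih =>
    intro _ _
    have hsimple : IsSimpleModule R (V ⧸ N) := by
      have : Nontrivial (V ⧸ N) := IsSimpleModule.nontrivial S _
      refine (isSimpleModule_iff_toSpanSingleton_surjective).mpr ⟨this, fun v hv w => ?_⟩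
      obtain ⟨s, hs⟩ := IsSimpleModule.toSpanSingleton_surjective S hv w
      have hm := IsSimpleModule.ker_toSpanSingleton_isMaximal S hv
      obtain ⟨r, hr⟩ := hess _ hm s
      refine ⟨r, ?_⟩
      rw [LinearMap.mem_ker, map_sub, hs, sub_eq_zero] at hr
      rw [← hr]
      simp
    rw [Module.length_eq_add_of_exact (R := S) N.subtype N.mkQ N.subtype_injective
        N.mkQ_surjective (LinearMap.exact_subtype_mkQ N),
      Module.length_eq_add_of_exact (R := R) (N.subtype.restrictScalars R)
        (N.mkQ.restrictScalars R) N.subtype_injective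
        N.mkQ_surjective (LinearMap.exact_subtype_mkQ N), ih,
      Module.length_eq_one S (V ⧸ N), Module.length_eq_one R (V ⧸ N)]

variable [Module R W]

/-- An injective map into the twist of a module of the same length is surjective. -/
theorem surjective_of_injective_of_twisted (σ : R →+* S)
    (hess : ∀ m : Ideal S, m.IsMaximal → ∀ s : S, ∃ r : R, σ r - s ∈ m)
    (hV : IsFiniteLength S V) (hlen : Module.length R W = Module.length S V)
    (x : W →+ V) (hx : ∀ (r : R) w, x (r • w) = σ r • x w)
    (hinj : Function.Injective x) : Function.Surjective x := by
  algebraize [σ]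
  let _ : Module R V := Module.compHom V σ
  have : IsScalarTower R S V := ⟨fun r s v => by
    rw [Algebra.smul_def, mul_smul]; rfl⟩
  have hl := length_eq_of_essential (R := R) hess hV
  have hfin : IsFiniteLength R V := by
    rw [← Module.length_ne_top_iff, hl, Module.length_ne_top_iff]
    exact hV
  obtain ⟨_, _⟩ := isFiniteLength_iff_isNoetherian_isArtinian.mp hfin
  let X : W →ₗ[R] V := { x with map_smul' := hx }
  have h1 : Module.length R (LinearMap.range X) = Module.length R V := by
    rw [← (LinearEquiv.ofInjective X hinj).length_eq, hlen, hl]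
  have h2 : LinearMap.range X = ⊤ := by
    by_contra hne
    exact (Submodule.length_lt hne).ne h1
  exact LinearMap.range_eq_top.mp h2

/-- A surjective map out of the twist of a module of the same length is injective. -/
theorem injective_of_surjective_of_twisted (σ : R →+* S)
    (hess : ∀ m : Ideal S, m.IsMaximal → ∀ s : S, ∃ r : R, σ r - s ∈ m)
    (hV : IsFiniteLength S V) (hlen : Module.length R W = Module.length S V)
    (y : V →+ W) (hy : ∀ (r : R) v, y (σ r • v) = r • y v)
    (hsurj : Function.Surjective y) : Function.Injective y := by
  algebraize [σ]
  let _ : Module R V := Module.compHom V σ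
  have : IsScalarTower R S V := ⟨fun r s v => by
    rw [Algebra.smul_def, mul_smul]; rfl⟩
  have hl := length_eq_of_essential (R := R) hess hV
  have hfin : Module.length R V ≠ ⊤ := by
    rw [hl, Module.length_ne_top_iff]
    exact hV
  let Y : V →ₗ[R] W := { y with map_smul' := hy }
  have h1 := Module.length_eq_add_of_exact (LinearMap.ker Y).subtype Y
    (Submodule.subtype_injective _) hsurj (LinearMap.exact_subtype_ker_map Y)
  rw [hlen, ← hl] at h1
  have h2 : Module.length R (LinearMap.ker Y) = 0 := by
    have h3 : Module.length R V + Module.length R (LinearMap.ker Y) = Module.length R V + 0 := by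
      rw [add_comm, ← h1, add_zero]
    exact ENat.add_right_injective_of_ne_top hfin h3
  rw [Module.length_eq_zero_iff, Submodule.subsingleton_iff_eq_bot] at h2
  exact LinearMap.ker_eq_bot.mp h2

theorem smul_iterate_of_twisted (τ : R →+* R) (y : W →+ W)
    (hy : ∀ (r : R) w, r • y w = y (τ r • w)) (n : ℕ) (r : R) (w : W) :
    r • y^[n] w = y^[n] ((τ ^ n) r • w) := by
  induction n generalizing r with
  | zero => rfl
  | succ n ih =>
    rw [Function.iterate_succ_apply', hy, ih, Function.iterate_succ_apply', pow_succ]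
    rfl

/-- An injective additive endomorphism `y` with `r y = y τ(r)` of an Artinian module is surjective:
the images of its powers form a descending chain of submodules. -/
theorem surjective_of_injective_of_isArtinian [IsArtinian R W] (τ : R →+* R) (y : W →+ W)
    (hy : ∀ (r : R) w, r • y w = y (τ r • w)) (hinj : Function.Injective y) :
    Function.Surjective y := by
  let c : ℕ →o (Submodule R W)ᵒᵈ :=
    { toFun := fun n => OrderDual.toDual
        { carrier := Set.range y^[n]
          zero_mem' := ⟨0, Function.iterate_fixed (map_zero y) n⟩
          add_mem' := by
            rintro _ _ ⟨a, rfl⟩ ⟨b, rfl⟩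
            exact ⟨a + b, iterate_map_add y n a b⟩
          smul_mem' := by
            rintro r _ ⟨a, rfl⟩
            exact ⟨_, (smul_iterate_of_twisted τ y hy n r a).symm⟩ }
      monotone' := monotone_nat_of_le_succ fun n => by
        rintro _ ⟨a, rfl⟩
        exact ⟨y a, rfl⟩ }
  obtain ⟨n, hn⟩ := IsArtinian.monotone_stabilizes c
  intro w
  have h : y^[n] w ∈ Set.range y^[n + 1] := by
    have h1 : y^[n] w ∈ OrderDual.ofDual (c n) := ⟨w, rfl⟩
    rw [hn (n + 1) (Nat.le_succ n)] at h1
    exact h1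
  obtain ⟨w', hw'⟩ := h
  exact ⟨w', hinj.iterate n hw'⟩

end Length

/-! ### Modules over a weak generalized Weyl algebra -/

namespace WGWA

variable {R : Type u} [CommRing R] {σ : R →+* R} {t : R}

theorem proj_surjective : Function.Surjective (proj σ t) := RingQuot.mkRingHom_surjective _

/-- `A` is generated as a ring by the image of `R` together with `X` and `Y`. -/
theorem induction_generators {p : WGWA σ t → Prop} (a : WGWA σ t) (coef : ∀ r, p (coef σ t r))
    (X : p (X σ t)) (Y : p (Y σ t)) (add : ∀ a b, p a → p b → p (a + b))
    (mul : ∀ a b, p a → p b → p (a * b)) : p a := by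
  obtain ⟨a, rfl⟩ := proj_surjective a
  induction a using FreeAlgebra.induction with
  | grade0 n =>
    convert coef (n : R) using 1
    rw [map_intCast]
    simp
  | grade1 g =>
    cases g with
    | coef r => exact coef r
    | X => exact X
    | Y => exact Y
  | mul a b ha hb => rw [map_mul]; exact mul _ _ ha hb
  | add a b ha hb => rw [map_add]; exact add _ _ ha hb

theorem Y_mul_X : Y σ t * X σ t = coef σ t t := by
  rw [X, Y, ← map_mul, proj_rel .YX]; rfl

theorem X_mul_Y : X σ t * Y σ t = coef σ t (σ t) := by
  rw [X, Y, ← map_mul, proj_rel .XY]; rfl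

theorem X_mul_coef (r : R) : X σ t * coef σ t r = coef σ t (σ r) * X σ t := by
  change proj σ t _ * proj σ t _ = proj σ t _ * proj σ t _
  rw [← map_mul, ← map_mul, proj_rel (.Xr r)]

theorem coef_mul_Y (r : R) : coef σ t r * Y σ t = Y σ t * coef σ t (σ r) := by
  change proj σ t _ * proj σ t _ = proj σ t _ * proj σ t _
  rw [← map_mul, ← map_mul, proj_rel (.rY r)]

section Module

variable {V W : Type*} [AddCommGroup V] [Module (WGWA σ t) V] [AddCommGroup W] [Module (WGWA σ t) W]

/-- A subgroup stable under the generators is a submodule. -/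
def submoduleOfStable (U : AddSubgroup V) (hc : ∀ r, ∀ v ∈ U, coef σ t r • v ∈ U)
    (hX : ∀ v ∈ U, X σ t • v ∈ U) (hY : ∀ v ∈ U, Y σ t • v ∈ U) : Submodule (WGWA σ t) V :=
  { U with
    smul_mem' := fun a => by
      induction a using induction_generators with
      | coef r => exact fun {v} hv => hc r v hv
      | X => exact fun {v} hv => hX v hv
      | Y => exact fun {v} hv => hY v hv
      | add a b ha hb => exact fun {v} hv => by rw [add_smul]; exact U.add_mem (ha hv) (hb hv)
      | mul a b ha hb => exact fun {v} hv => by rw [mul_smul]; exact ha (hb hv) }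

/-- An additive map commuting with the generators is linear. -/
def linearMapOfCommute (F : V →+ W) (hc : ∀ r v, F (coef σ t r • v) = coef σ t r • F v)
    (hX : ∀ v, F (X σ t • v) = X σ t • F v) (hY : ∀ v, F (Y σ t • v) = Y σ t • F v) :
    V →ₗ[WGWA σ t] W :=
  { F with
    map_smul' := fun a v => by
      change F (a • v) = a • F v
      induction a using induction_generators generalizing v with
      | coef r => exact hc r v
      | X => exact hX v
      | Y => exact hY v
      | add a b ha hb => rw [add_smul, map_add, ha, hb, add_smul]
      | mul a b ha hb => rw [mul_smul, ha, hb, mul_smul] }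

/-- A stable subgroup of a simple module with a nonzero element is everything. -/
theorem mem_of_stable [IsSimpleModule (WGWA σ t) V] (U : AddSubgroup V)
    (hc : ∀ r, ∀ v ∈ U, coef σ t r • v ∈ U) (hX : ∀ v ∈ U, X σ t • v ∈ U)
    (hY : ∀ v ∈ U, Y σ t • v ∈ U) {u : V} (hu : u ∈ U) (hu0 : u ≠ 0) (v : V) : v ∈ U := by
  have h : submoduleOfStable U hc hX hY = ⊤ := by
    refine (eq_bot_or_eq_top _).resolve_left fun h => hu0 ?_
    have : u ∈ submoduleOfStable U hc hX hY := hu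
    rw [h] at this
    exact this
  have : v ∈ submoduleOfStable U hc hX hY := by rw [h]; trivial
  exact this

end Module

/-! ### A criterion for weight modules of finite length -/

section Criterion

variable {V : Type v} [AddCommGroup V] [Module (WGWA σ t) V]

theorem mul_sub_one_mem (m : MaximalSpectrum R) {r : R} (hr : r ∉ m.asIdeal) :
    ∃ s, s * r - 1 ∈ m.asIdeal := by
  let _ := Ideal.Quotient.field m.asIdeal
  obtain ⟨s, hs⟩ := Ideal.Quotient.mk_surjective (Ideal.Quotient.mk m.asIdeal r)⁻¹
  refine ⟨s, Ideal.Quotient.eq.mp ?_⟩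
  rw [map_mul, hs, map_one, inv_mul_cancel₀]
  rwa [Ne, Ideal.Quotient.eq_zero_iff_mem]

/-- The weight spaces of any module are independent. -/
theorem weightSpace_injective [DecidableEq (MaximalSpectrum R)] :
    Function.Injective (DirectSum.coeAddMonoidHom (weightSpace σ t V)) := by
  classical
  rw [injective_iff_map_eq_zero]
  intro x hx
  ext m
  -- `r` lies in every other weight of `x` but not in `m`, so that `r` isolates the component `x m`.
  obtain ⟨r, hr, hrm⟩ : ∃ r ∈ ∏ n ∈ x.support.erase m, n.asIdeal, r ∉ m.asIdeal := by
    by_contra! h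
    obtain ⟨n, hn, hnm⟩ := (Ideal.IsPrime.prod_le m.isMaximal.isPrime).mp
      (show ∏ n ∈ x.support.erase m, n.asIdeal ≤ m.asIdeal from h)
    exact (Finset.mem_erase.mp hn).1
      (MaximalSpectrum.ext (n.isMaximal.eq_of_le m.isMaximal.ne_top hnm))
  have h1 : coef σ t r • (x m : V) = 0 := by
    rw [DirectSum.coeAddMonoidHom_eq_dfinsuppSum, DFinsupp.sum] at hx
    have h2 := congrArg (coef σ t r • ·) hx
    simp only [smul_zero, Finset.smul_sum] at h2
    by_cases hm : m ∈ x.support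
    · rwa [Finset.sum_eq_single_of_mem m hm] at h2
      intro n hn hnm
      exact (x n).2 r
        (Ideal.le_of_dvd (Finset.dvd_prod_of_mem _ (Finset.mem_erase.mpr ⟨hnm, hn⟩)) hr)
    · rw [DFinsupp.notMem_support_iff.mp hm]
      simp
  obtain ⟨s, hs⟩ := mul_sub_one_mem m hrm
  have h3 := (x m).2 _ hs
  rw [map_sub, map_mul, sub_smul, mul_smul, h1, smul_zero, map_one, one_smul, zero_sub,
    neg_eq_zero] at h3
  simpa using h3

/-- A module spanned over `R` by finitely many weight vectors is a weight module of finite length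
over `R`. -/
theorem isWeight_and_finiteLength {ι : Type*} [Fintype ι] (m : ι → MaximalSpectrum R) (w : ι → V)
    (hw : ∀ i, w i ∈ weightSpace σ t V (m i))
    (hspan : ∀ v, ∃ c : ι → R, v = ∑ i, coef σ t (c i) • w i) :
    IsWeight σ t V ∧ FiniteLengthOverBase σ t V := by
  constructor
  · classical
    refine ⟨by convert weightSpace_injective (σ := σ) (t := t) (V := V), fun v => ?_⟩
    obtain ⟨c, rfl⟩ := hspan v
    have hmem : ∀ i, coef σ t (c i) • w i ∈ weightSpace σ t V (m i) := fun i r hr => by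
      rw [← mul_smul, ← map_mul, mul_comm, map_mul, mul_smul, hw i r hr, smul_zero]
    refine ⟨∑ i, DirectSum.of (fun m => weightSpace σ t V m) (m i) ⟨_, hmem i⟩, ?_⟩
    rw [map_sum]
    refine Finset.sum_congr rfl fun i _ => ?_
    convert DirectSum.coeAddMonoidHom_of (weightSpace σ t V) (m i) ⟨_, hmem i⟩
  · classical
    let _ : Module R V := Module.compHom V (coef σ t)
    change IsFiniteLength R V
    have hle : ∀ i, (m i).asIdeal ≤ LinearMap.ker (LinearMap.toSpanSingleton R V (w i)) :=
      fun i r hr => hw i r hr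
    let φ : (∀ i, R ⧸ (m i).asIdeal) →ₗ[R] V :=
      LinearMap.lsum R _ R fun i => Submodule.liftQ _ _ (hle i)
    have hφ : Function.Surjective φ := by
      intro v
      obtain ⟨c, rfl⟩ := hspan v
      refine ⟨fun i => Submodule.Quotient.mk (c i), ?_⟩
      simp only [φ]
      rw [LinearMap.lsum_apply, LinearMap.sum_apply]
      rfl
    have : ∀ i, IsSimpleModule R (R ⧸ (m i).asIdeal) := fun i =>
      isSimpleModule_iff_isCoatom.mpr (m i).isMaximal.out
    refine IsFiniteLength.of_surjective (f := φ) ?_ hφ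
    rw [isFiniteLength_iff_isNoetherian_isArtinian]
    exact ⟨inferInstance, inferInstance⟩

end Criterion

/-! ### Weights and the operators `X`, `Y` -/

/-- The unique maximal ideal `σ⁻¹(𝔪)` below `𝔪`. -/
def lower (hσ : IsEssential σ) (m : MaximalSpectrum R) : MaximalSpectrum R where
  asIdeal := m.asIdeal.comap σ
  isMaximal := by
    let _ := Ideal.Quotient.field m.asIdeal
    have h : Function.Surjective ((Ideal.Quotient.mk m.asIdeal).comp σ) := fun y => by
      obtain ⟨⟨_, s, rfl⟩, hs⟩ := hσ m y
      exact ⟨s, hs⟩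
    have h1 : m.asIdeal.comap σ = RingHom.ker ((Ideal.Quotient.mk m.asIdeal).comp σ) :=
      Ideal.ext fun r => by
        rw [Ideal.mem_comap, RingHom.mem_ker, RingHom.comp_apply, Ideal.Quotient.eq_zero_iff_mem]
    rw [h1]
    exact RingHom.ker_isMaximal_of_surjective _ h

theorem Below.eq_lower (hσ : IsEssential σ) {n m : MaximalSpectrum R} (h : Below σ n m) :
    n = lower hσ m :=
  MaximalSpectrum.ext (n.isMaximal.eq_of_le (lower hσ m).isMaximal.ne_top h)

theorem below_lower (hσ : IsEssential σ) (m : MaximalSpectrum R) : Below σ (lower hσ m) m := le_rfl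

theorem IsEssential.exists_sub_mem (hσ : IsEssential σ) (m : MaximalSpectrum R) (r : R) :
    ∃ s, σ s - r ∈ m.asIdeal := by
  obtain ⟨⟨_, s, rfl⟩, hs⟩ := hσ m (Ideal.Quotient.mk _ r)
  exact ⟨s, Ideal.Quotient.eq.mp hs⟩

section Weights

variable {V : Type v} [AddCommGroup V] [Module R V]

/-- `v` is killed by the maximal ideal `𝔪`. -/
def HasWeight (m : MaximalSpectrum R) (v : V) : Prop := ∀ r ∈ m.asIdeal, r • v = 0

theorem HasWeight.smul_congr {m : MaximalSpectrum R} {v : V} (h : HasWeight m v) {r s : R}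
    (hrs : r - s ∈ m.asIdeal) : r • v = s • v := by
  rw [← sub_eq_zero, ← sub_smul, h _ hrs]

theorem HasWeight.exists_smul_smul {m : MaximalSpectrum R} {v : V} (h : HasWeight m v) {r : R}
    (hr : r ∉ m.asIdeal) : ∃ s : R, s • r • v = v := by
  obtain ⟨s, hs⟩ := mul_sub_one_mem m hr
  exact ⟨s, by rw [← mul_smul, h.smul_congr hs, one_smul]⟩

theorem HasWeight.mem_of_smul_eq_zero {m : MaximalSpectrum R} {v : V} (h : HasWeight m v)
    (hv : v ≠ 0) {r : R} (hr : r • v = 0) : r ∈ m.asIdeal := by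
  by_contra hrm
  obtain ⟨s, hs⟩ := h.exists_smul_smul hrm
  exact hv (by rw [← hs, hr, smul_zero])

/-- Nonzero Artinian modules contain weight vectors. -/
theorem exists_hasWeight [IsArtinian R V] {U : Submodule R V} (hU : U ≠ ⊥) :
    ∃ v ∈ U, v ≠ 0 ∧ ∃ m : MaximalSpectrum R, HasWeight m v := by
  obtain ⟨S, hS, hSU⟩ := (eq_bot_or_exists_atom_le U).resolve_left hU
  obtain ⟨v, hv, hv0⟩ := S.ne_bot_iff.mp hS.1
  have hS' := isSimpleModule_iff_isAtom.mpr hS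
  refine ⟨v, hSU hv, hv0, ⟨LinearMap.ker (LinearMap.toSpanSingleton R S ⟨v, hv⟩),
    IsSimpleModule.ker_toSpanSingleton_isMaximal R fun h => hv0 (congrArg Subtype.val h)⟩,
    fun r hr => congrArg Subtype.val (LinearMap.mem_ker.mp hr)⟩

/-- If `y` satisfies `r y = y σ(r)`, then it lowers weights. -/
theorem HasWeight.map (hσ : IsEssential σ) {y : V → V} (hy0 : y 0 = 0)
    (hy : ∀ (r : R) v, r • y v = y (σ r • v))
    {m : MaximalSpectrum R} {v : V} (h : HasWeight m v) : HasWeight (lower hσ m) (y v) :=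
  fun r hr => by rw [hy, h (σ r) hr, hy0]

theorem HasWeight.iterate (hσ : IsEssential σ) {y : V → V} (hy0 : y 0 = 0)
    (hy : ∀ (r : R) v, r • y v = y (σ r • v))
    {m : MaximalSpectrum R} {v : V} (h : HasWeight m v) (n : ℕ) :
    HasWeight ((lower hσ)^[n] m) (y^[n] v) := by
  induction n with
  | zero => exact h
  | succ n ih =>
    rw [Function.iterate_succ_apply', Function.iterate_succ_apply']
    exact ih.map hσ hy0 hy

variable [Module (WGWA σ t) V]

theorem Y_smul_X_smul (hc : ∀ (r : R) (v : V), coef σ t r • v = r • v) (v : V) :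
    Y σ t • X σ t • v = t • v := by rw [← mul_smul, Y_mul_X, hc]

theorem X_smul_Y_smul (hc : ∀ (r : R) (v : V), coef σ t r • v = r • v) (v : V) :
    X σ t • Y σ t • v = σ t • v := by rw [← mul_smul, X_mul_Y, hc]

theorem X_smul_smul (hc : ∀ (r : R) (v : V), coef σ t r • v = r • v) (r : R) (v : V) :
    X σ t • r • v = σ r • X σ t • v := by
  rw [← hc, ← hc, ← mul_smul, X_mul_coef, mul_smul]

theorem smul_Y_smul (hc : ∀ (r : R) (v : V), coef σ t r • v = r • v) (r : R) (v : V) :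
    r • Y σ t • v = Y σ t • σ r • v := by
  rw [← hc, ← hc, ← mul_smul, coef_mul_Y, mul_smul]

/-- `Y` is not semilinear over `R` in the usual sense, but on weight vectors essentiality supplies
scalars that can be moved past it. -/
theorem HasWeight.Y_smul_smul (hσ : IsEssential σ)
    (hc : ∀ (r : R) (v : V), coef σ t r • v = r • v) {m : MaximalSpectrum R} {v : V}
    (h : HasWeight m v) (r : R) : ∃ s : R, Y σ t • r • v = s • Y σ t • v := by
  obtain ⟨s, hs⟩ := hσ.exists_sub_mem m r
  exact ⟨s, by rw [smul_Y_smul hc, h.smul_congr hs]⟩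

/-- In a simple module, an `R`-span of weight vectors which `X` and `Y` map into it is everything
as soon as it is not zero. -/
theorem span_eq_top_of_stable (hσ : IsEssential σ) [IsSimpleModule (WGWA σ t) V]
    (hc : ∀ (r : R) (v : V), coef σ t r • v = r • v) (G : Set V)
    (hG : ∀ g ∈ G, ∃ m : MaximalSpectrum R, HasWeight m g)
    (hX : ∀ g ∈ G, X σ t • g ∈ Submodule.span R G)
    (hY : ∀ g ∈ G, Y σ t • g ∈ Submodule.span R G) {u : V} (hu : u ∈ G) (hu0 : u ≠ 0) :
    Submodule.span R G = ⊤ := by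
  rw [eq_top_iff]
  intro v _
  refine mem_of_stable (σ := σ) (t := t) (Submodule.span R G).toAddSubgroup
    (fun r v hv => ?_) (fun v hv => ?_) (fun v hv => ?_)
    (show u ∈ Submodule.span R G from Submodule.subset_span hu) hu0 v
  · rw [hc]
    exact Submodule.smul_mem _ r hv
  · change X σ t • v ∈ Submodule.span R G
    have hv' : v ∈ Submodule.span R G := hv
    induction hv' using Submodule.span_induction with
    | mem g hg => exact hX g hg
    | zero => rw [smul_zero]; exact Submodule.zero_mem _
    | add a b ha hb h1 h2 => rw [smul_add]; exact Submodule.add_mem _ (h1 ha) (h2 hb)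
    | smul r a ha h1 => rw [X_smul_smul hc]; exact Submodule.smul_mem _ _ (h1 ha)
  · change Y σ t • v ∈ Submodule.span R G
    have hv' : v ∈ Submodule.span R G := hv
    -- `Y` is not semilinear, hence the induction over all multiples of `v`.
    suffices h : ∀ r : R, Y σ t • r • v ∈ Submodule.span R G by simpa using h 1
    clear hv
    induction hv' using Submodule.span_induction with
    | mem g hg =>
      intro r
      obtain ⟨m, hm⟩ := hG g hg
      obtain ⟨s, hs⟩ := hm.Y_smul_smul hσ hc r
      rw [hs]
      exact Submodule.smul_mem _ _ (hY g hg)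
    | zero => intro r; rw [smul_zero, smul_zero]; exact Submodule.zero_mem _
    | add a b ha hb h1 h2 =>
      intro r
      rw [smul_add, smul_add]
      exact Submodule.add_mem _ (h1 r) (h2 r)
    | smul s a ha h1 => intro r; rw [← mul_smul]; exact h1 _

end Weights

/-! ### Recognition of bounded string modules -/

section StringModules

theorem BoundedString.coef_smul (hσ : IsEssential σ) {n : ℕ} (s : BoundedSeq σ t n) (r : R)
    (v : BoundedString hσ s) (i : Fin (n + 1)) : (coef σ t r • v) i = r • v i := by
  change (rep hσ s).toHom (coef σ t r) v i = _
  rw [Rep.toHom_coef]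
  rfl

theorem BoundedString.X_smul_zero (hσ : IsEssential σ) {n : ℕ} (s : BoundedSeq σ t n)
    (v : BoundedString hσ s) : (X σ t • v) 0 = 0 := by
  change (rep hσ s).toHom (X σ t) v 0 = _
  rw [Rep.toHom_X]
  rfl

theorem BoundedString.X_smul_succ (hσ : IsEssential σ) {n : ℕ} (s : BoundedSeq σ t n)
    (v : BoundedString hσ s) (i : Fin n) :
    (X σ t • v) i.succ = resEquiv hσ (s.chain i) (t • v i.castSucc) := by
  change (rep hσ s).toHom (X σ t) v i.succ = _
  rw [Rep.toHom_X]
  rfl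

theorem BoundedString.Y_smul_last (hσ : IsEssential σ) {n : ℕ} (s : BoundedSeq σ t n)
    (v : BoundedString hσ s) : (Y σ t • v) (Fin.last n) = 0 := by
  change (rep hσ s).toHom (Y σ t) v (Fin.last n) = _
  rw [Rep.toHom_Y]
  change (Fin.snoc (α := fun i => Res (s.m i))
    (fun i : Fin n => (resEquiv hσ (s.chain i)).symm (v i.succ)) 0 : ∀ i, Res (s.m i))
      (Fin.last n) = _
  rw [Fin.snoc_last]

theorem BoundedString.Y_smul_castSucc (hσ : IsEssential σ) {n : ℕ} (s : BoundedSeq σ t n)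
    (v : BoundedString hσ s) (i : Fin n) :
    (Y σ t • v) i.castSucc = (resEquiv hσ (s.chain i)).symm (v i.succ) := by
  change (rep hσ s).toHom (Y σ t) v i.castSucc = _
  rw [Rep.toHom_Y]
  change (Fin.snoc (α := fun i => Res (s.m i))
    (fun i : Fin n => (resEquiv hσ (s.chain i)).symm (v i.succ)) 0 : ∀ i, Res (s.m i))
      i.castSucc = _
  rw [Fin.snoc_castSucc]

variable {V : Type v} [AddCommGroup V] [Module R V]

/-- The map `R / 𝔪 → V`, `r ↦ r e`, given by a weight vector `e`. -/
def ofWeightVector {m : MaximalSpectrum R} {e : V} (h : HasWeight m e) : Res m →ₗ[R] V :=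
  Submodule.liftQ _ (LinearMap.toSpanSingleton R V e) h

theorem ofWeightVector_mk {m : MaximalSpectrum R} {e : V} (h : HasWeight m e) (r : R) :
    ofWeightVector h (Ideal.Quotient.mk _ r) = r • e := rfl

variable [Module (WGWA σ t) V]

/-- A chain of weight vectors linked by `X` and `Y` in the manner of a bounded string module
identifies a simple module with that string module. -/
theorem isBoundedString_of_chain (hσ : IsEssential σ) [IsSimpleModule (WGWA σ t) V]
    (hc : ∀ (r : R) (v : V), coef σ t r • v = r • v) {n : ℕ} (s : BoundedSeq σ t n)
    (e : Fin (n + 1) → V) (he : ∀ i, HasWeight (s.m i) (e i)) (h0 : e 0 ≠ 0)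
    (hX : ∀ i : Fin n, X σ t • e i.castSucc = σ t • e i.succ) (hXlast : X σ t • e (Fin.last n) = 0)
    (hY : ∀ i : Fin n, Y σ t • e i.succ = e i.castSucc) (hY0 : Y σ t • e 0 = 0) :
    IsBoundedString hσ t V := by
  have hXg : ∀ (i : Fin n) z, X σ t • ofWeightVector (he i.castSucc) z =
      ofWeightVector (he i.succ) (resEquiv hσ (s.chain i) (t • z)) := by
    intro i z
    obtain ⟨r, rfl⟩ := Ideal.Quotient.mk_surjective z
    rw [ofWeightVector_mk, X_smul_smul hc, hX, resEquiv_smul, map_smul, resEquiv_mk,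
      ofWeightVector_mk, smul_comm]
  have hYg : ∀ (i : Fin n) z, Y σ t • ofWeightVector (he i.succ) z =
      ofWeightVector (he i.castSucc) ((resEquiv hσ (s.chain i)).symm z) := by
    intro i z
    obtain ⟨z, rfl⟩ := (resEquiv hσ (s.chain i)).surjective z
    obtain ⟨r, rfl⟩ := Ideal.Quotient.mk_surjective z
    rw [RingEquiv.symm_apply_apply, resEquiv_mk, ofWeightVector_mk, ofWeightVector_mk,
      ← smul_Y_smul hc, hY]
  have hXlast' : ∀ z, X σ t • ofWeightVector (he (Fin.last n)) z = 0 := by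
    intro z
    obtain ⟨r, rfl⟩ := Ideal.Quotient.mk_surjective z
    rw [ofWeightVector_mk, X_smul_smul hc, hXlast, smul_zero]
  have hY0' : ∀ z, Y σ t • ofWeightVector (he 0) z = 0 := by
    intro z
    obtain ⟨r, rfl⟩ := Ideal.Quotient.mk_surjective z
    obtain ⟨r', hr'⟩ := (he 0).Y_smul_smul hσ hc r
    rw [ofWeightVector_mk, hr', hY0, smul_zero]
  let F : BoundedString hσ s →+ V :=
    { toFun := fun v => ∑ i, ofWeightVector (he i) (v i)
      map_zero' := Finset.sum_eq_zero fun i _ => map_zero _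
      map_add' := fun v w => by
        rw [← Finset.sum_add_distrib]
        exact Finset.sum_congr rfl fun i _ => map_add _ _ _ }
  have hF : ∀ v, F v = ∑ i, ofWeightVector (he i) (v i) := fun _ => rfl
  let G : BoundedString hσ s →ₗ[WGWA σ t] V := linearMapOfCommute F
    (fun r v => by
      rw [hc, hF, hF, Finset.smul_sum]
      exact Finset.sum_congr rfl fun i _ => by rw [BoundedString.coef_smul, map_smul])
    (fun v => by
      rw [hF, hF, Finset.smul_sum, Fin.sum_univ_succ, Fin.sum_univ_castSucc, hXlast', add_zero,
        BoundedString.X_smul_zero, map_zero, zero_add]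
      exact Finset.sum_congr rfl fun i _ => by rw [hXg, BoundedString.X_smul_succ])
    (fun v => by
      rw [hF, hF, Finset.smul_sum, Fin.sum_univ_castSucc, Fin.sum_univ_succ, hY0', zero_add,
        BoundedString.Y_smul_last, map_zero, add_zero]
      exact Finset.sum_congr rfl fun i _ => by rw [hYg, BoundedString.Y_smul_castSucc])
  have hG : ∀ v, G v = ∑ i, ofWeightVector (he i) (v i) := fun _ => rfl
  have hne : G ≠ 0 := by
    intro h
    let w : BoundedString hσ s := (Pi.single (M := fun i => Res (s.m i)) 0 1 : ∀ i, Res (s.m i))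
    have h1 : ∑ i, ofWeightVector (he i) (w i) = 0 := LinearMap.congr_fun h w
    rw [Finset.sum_eq_single 0] at h1
    · have hw : w 0 = Ideal.Quotient.mk _ 1 := Pi.single_eq_same _ _
      rw [hw, ofWeightVector_mk, one_smul] at h1
      exact h0 h1
    · intro i _ hi
      have hw : w i = 0 := Pi.single_eq_of_ne hi _
      rw [hw, map_zero]
    · exact fun h => absurd (Finset.mem_univ _) h
  -- `Y` moves the highest nonzero component of an element of the kernel down to the bottom.
  have hinj : ∀ (k : ℕ) (v : BoundedString hσ s), G v = 0 →
      (∀ i : Fin (n + 1), k ≤ i → v i = 0) → v = 0 := by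
    intro k
    induction k with
    | zero => exact fun v _ h => funext fun i => h i (Nat.zero_le _)
    | succ k ih =>
      intro v hv h
      have hw : Y σ t • v = 0 := by
        refine ih _ (by rw [map_smul, hv, smul_zero]) fun i => ?_
        refine Fin.lastCases (fun _ => ?_) (fun i hi => ?_) i
        · exact BoundedString.Y_smul_last hσ s v
        · have : v i.succ = 0 := h _ (by simpa using hi)
          rw [BoundedString.Y_smul_castSucc, this, map_zero]
      have hsucc : ∀ i : Fin n, v i.succ = 0 := by
        intro i
        have h1 := BoundedString.Y_smul_castSucc hσ s v i
        rw [hw] at h1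
        exact (map_eq_zero_iff _ (resEquiv hσ (s.chain i)).symm.injective).mp h1.symm
      have hv0 : v 0 = 0 := by
        rw [hG, Fin.sum_univ_succ, Finset.sum_eq_zero (fun i _ => by rw [hsucc, map_zero]),
          add_zero] at hv
        obtain ⟨r, hr⟩ := Ideal.Quotient.mk_surjective (v 0)
        rw [← hr, ofWeightVector_mk] at hv
        rw [← hr, Ideal.Quotient.eq_zero_iff_mem]
        exact (he 0).mem_of_smul_eq_zero h0 hv
      funext i
      exact Fin.cases hv0 hsucc i
  refine ⟨n, s, ⟨(LinearEquiv.ofBijective G ⟨?_, LinearMap.surjective_of_ne_zero hne⟩).symm⟩⟩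
  rw [injective_iff_map_eq_zero]
  exact fun v hv => hinj (n + 1) v hv fun i hi => absurd i.2 (by omega)

end StringModules

/-! ### Modules on which `X` is not injective -/

section Highest

variable {V : Type v} [AddCommGroup V] [Module R V] [Module (WGWA σ t) V]

/-- The operator `Y` on `V`. -/
noncomputable def opY (σ : R →+* R) (t : R) (V : Type v) [AddCommGroup V]
    [Module (WGWA σ t) V] : V →+ V :=
  DistribSMul.toAddMonoidHom V (Y σ t)

/-- The operator `X` on `V`. -/
noncomputable def opX (σ : R →+* R) (t : R) (V : Type v) [AddCommGroup V]
    [Module (WGWA σ t) V] : V →+ V :=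
  DistribSMul.toAddMonoidHom V (X σ t)

variable (σ t) in
/-- The `R`-span of `Yʲu, Yʲ⁺¹u, …`. -/
noncomputable def tail (u : V) (j : ℕ) : Submodule R V :=
  Submodule.span R (Set.range fun b => (opY σ t V)^[j + b] u)

theorem iterate_mem_tail (u : V) {i j : ℕ} (h : j ≤ i) : (opY σ t V)^[i] u ∈ tail σ t u j :=
  Submodule.subset_span ⟨i - j, by simp only [Nat.add_sub_cancel' h]⟩

theorem tail_anti (u : V) {i j : ℕ} (h : i ≤ j) : tail σ t u j ≤ tail σ t u i := by
  refine Submodule.span_le.mpr ?_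
  rintro _ ⟨b, rfl⟩
  exact iterate_mem_tail u (by omega)

theorem smul_opY (hc : ∀ (r : R) (v : V), coef σ t r • v = r • v) (r : R) (v : V) :
    r • opY σ t V v = opY σ t V (σ r • v) := smul_Y_smul hc r v

theorem X_smul_opY (hc : ∀ (r : R) (v : V), coef σ t r • v = r • v) (v : V) :
    X σ t • opY σ t V v = σ t • v := X_smul_Y_smul hc v

/-- If `X` kills `Yʲu ≠ 0`, then `∑_{b ≥ j} R Yᵇu` is a nonzero submodule. -/
theorem tail_eq_top (hσ : IsEssential σ) (hc : ∀ (r : R) (v : V), coef σ t r • v = r • v)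
    [IsSimpleModule (WGWA σ t) V] {m : MaximalSpectrum R} {u : V} (hm : HasWeight m u) {j : ℕ}
    (hX : X σ t • (opY σ t V)^[j] u = 0) (hne : (opY σ t V)^[j] u ≠ 0) : tail σ t u j = ⊤ := by
  refine span_eq_top_of_stable hσ hc _ ?_ ?_ ?_ ⟨0, rfl⟩ hne
  · rintro _ ⟨b, rfl⟩
    exact ⟨_, hm.iterate hσ (map_zero _) (smul_opY hc) _⟩
  · rintro _ ⟨b, rfl⟩
    cases b with
    | zero => simp only [add_zero, hX, Submodule.zero_mem]
    | succ b =>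
      simp only [← add_assoc, Function.iterate_succ_apply']
      rw [X_smul_opY hc]
      exact Submodule.smul_mem _ _ (iterate_mem_tail u (by omega))
  · rintro _ ⟨b, rfl⟩
    change opY σ t V _ ∈ _
    simp only [← Function.iterate_succ_apply']
    exact iterate_mem_tail u (by omega)

/-- If `u ∈ ∑_{b ≥ 1} R Yᵇu`, then `Y` is onto: its image is an `R`-submodule containing all
`Yᵇu`, and these span `V`. -/
theorem opY_surjective (hσ : IsEssential σ) (hc : ∀ (r : R) (v : V), coef σ t r • v = r • v)
    [IsSimpleModule (WGWA σ t) V] {m : MaximalSpectrum R} {u : V} (hm : HasWeight m u)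
    (hX : X σ t • u = 0) (hu : u ≠ 0) (h1 : u ∈ tail σ t u 1) :
    Function.Surjective (opY σ t V) := by
  let I : Submodule R V :=
    { AddMonoidHom.range (opY σ t V) with
      smul_mem' := by
        rintro r _ ⟨v, rfl⟩
        exact ⟨_, (smul_opY hc r v).symm⟩ }
  have hI : tail σ t u 1 ≤ I := by
    refine Submodule.span_le.mpr ?_
    rintro _ ⟨b, rfl⟩
    exact ⟨(opY σ t V)^[b] u, by simp only [add_comm 1 b, Function.iterate_succ_apply']⟩
  have h0 : tail σ t u 0 ≤ I := by
    refine Submodule.span_le.mpr ?_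
    rintro _ ⟨b, rfl⟩
    cases b with
    | zero => exact hI h1
    | succ b => exact hI (iterate_mem_tail u (by omega))
  intro v
  have hv : v ∈ tail σ t u 0 := by
    rw [tail_eq_top hσ hc hm (j := 0) hX hu]
    trivial
  exact h0 hv

/-- If `u ∉ ∑_{b ≥ 1} R Yᵇu`, then some `Yᴺu` is killed by `σ(t)`. Otherwise `X` would carry the
relation `Yⁿu ∈ ∑_{b > n} R Yᵇu`, valid for large `n`, back to `u ∈ ∑_{b ≥ 1} R Yᵇu`. -/
theorem exists_smul_iterate_eq_zero (hσ : IsEssential σ)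
    (hc : ∀ (r : R) (v : V), coef σ t r • v = r • v) [IsArtinian R V]
    {m : MaximalSpectrum R} {u : V} (hm : HasWeight m u)
    (h1 : u ∉ tail σ t u 1) : ∃ N, σ t • (opY σ t V)^[N] u = 0 := by
  by_contra! hne
  have hw := fun n => hm.iterate hσ (map_zero (opY σ t V)) (smul_opY hc) n
  have hdown : ∀ n, (opY σ t V)^[n] u ∈ tail σ t u (n + 1) → u ∈ tail σ t u 1 := by
    intro n
    induction n with
    | zero => exact id
    | succ n ih =>
      intro h
      refine ih ?_
      have hX : ∀ v ∈ tail σ t u (n + 1 + 1), X σ t • v ∈ tail σ t u (n + 1) := by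
        intro v hv
        induction hv using Submodule.span_induction with
        | mem g hg =>
          obtain ⟨b, rfl⟩ := hg
          have : n + 1 + 1 + b = (n + 1 + b) + 1 := by omega
          simp only [this, Function.iterate_succ_apply']
          rw [X_smul_opY hc]
          exact Submodule.smul_mem _ _ (iterate_mem_tail u (by omega))
        | zero => rw [smul_zero]; exact Submodule.zero_mem _
        | add a b _ _ ha hb => rw [smul_add]; exact Submodule.add_mem _ ha hb
        | smul r a _ ha => rw [X_smul_smul hc]; exact Submodule.smul_mem _ _ ha
      have h2 := hX _ h
      rw [Function.iterate_succ_apply', X_smul_opY hc] at h2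
      have h3 : σ t ∉ ((lower hσ)^[n] m).asIdeal := fun h3 => hne n (hw n _ h3)
      obtain ⟨s, hs⟩ := (hw n).exists_smul_smul h3
      rw [← hs]
      exact Submodule.smul_mem _ _ h2
  let c : ℕ →o (Submodule R V)ᵒᵈ :=
    { toFun := fun n => OrderDual.toDual (tail σ t u n)
      monotone' := fun i j hij => tail_anti u hij }
  obtain ⟨n, hn⟩ := IsArtinian.monotone_stabilizes c
  refine h1 (hdown n ?_)
  have h2 : (opY σ t V)^[n] u ∈ OrderDual.ofDual (c n) := iterate_mem_tail u le_rfl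
  rw [hn (n + 1) (Nat.le_succ n)] at h2
  exact h2

/-- A simple module with a weight vector `u` killed by `X` is a bounded string module, provided that
`u ∉ ∑_{b ≥ 1} R Yᵇu`. Its maximal ideals are the weights of `Yᴺu, …, Yu, u`, where `N` is the
least number with `σ(t) Yᴺu = 0`. -/
theorem isBoundedString_of_X_smul_eq_zero (hσ : IsEssential σ)
    (hc : ∀ (r : R) (v : V), coef σ t r • v = r • v) [IsArtinian R V]
    [IsSimpleModule (WGWA σ t) V] {m : MaximalSpectrum R} {u : V} (hm : HasWeight m u)
    (hX : X σ t • u = 0) (hu : u ≠ 0) (h1 : u ∉ tail σ t u 1) : IsBoundedString hσ t V := by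
  classical
  have hex := exists_smul_iterate_eq_zero hσ hc hm h1
  have hw := fun n => hm.iterate hσ (map_zero (opY σ t V)) (smul_opY hc) n
  obtain ⟨N, hN, hmin⟩ : ∃ N, σ t • (opY σ t V)^[N] u = 0 ∧
      ∀ n < N, σ t • (opY σ t V)^[n] u ≠ 0 :=
    ⟨Nat.find hex, Nat.find_spec hex, fun n hn => Nat.find_min hex hn⟩
  have hXY : ∀ n, X σ t • (opY σ t V)^[n + 1] u = σ t • (opY σ t V)^[n] u := by
    intro n
    rw [Function.iterate_succ_apply', X_smul_opY hc]
  have hN0 : (opY σ t V)^[N] u ≠ 0 := by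
    cases N with
    | zero => exact hu
    | succ N =>
      intro h
      refine hmin N (Nat.lt_succ_self N) ?_
      rw [← hXY, h, smul_zero]
  -- Otherwise `∑_{b > N} R Yᵇu` is a nonzero submodule, hence everything, and contains `u`.
  have hN1 : (opY σ t V)^[N + 1] u = 0 := by
    by_contra hne
    refine h1 (tail_anti u (Nat.le_add_left 1 N) ?_)
    rw [tail_eq_top hσ hc hm ((hXY N).trans hN) hne]
    trivial
  let s : BoundedSeq σ t N :=
    { m := fun i => (lower hσ)^[N - i] m
      chain := fun i => by
        have : N - (i.castSucc : ℕ) = (N - (i.succ : ℕ)) + 1 := by simp; omega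
        rw [this, Function.iterate_succ_apply']
        exact below_lower hσ _
      lowest := (hw N).mem_of_smul_eq_zero hN0 hN
      highest := by
        have : N - ((Fin.last N : Fin (N + 1)) : ℕ) = 0 := by simp
        rw [this]
        refine hm.mem_of_smul_eq_zero hu ?_
        rw [← Y_smul_X_smul hc, hX, smul_zero] }
  have hsucc : ∀ i : Fin N, N - (i.castSucc : ℕ) = (N - (i.succ : ℕ)) + 1 := fun i => by
    simp; omega
  refine isBoundedString_of_chain hσ hc s (fun i => (opY σ t V)^[N - i] u) (fun i => hw _) hN0
    (fun i => ?_) ?_ (fun i => ?_) ?_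
  · simp only [hsucc, hXY]
  · simpa using hX
  · simp only [hsucc, Function.iterate_succ_apply']
    rfl
  · rw [Function.iterate_succ_apply'] at hN1
    exact hN1

end Highest

/-! ### Cycles of maximal ideals -/

section Cycles

variable {V : Type v} [AddCommGroup V] [Module R V]

/-- Weight vectors of weights different from that of `v` do not span `v`. -/
theorem HasWeight.exists_eq_of_mem_span {m : MaximalSpectrum R} {v : V} (hv : HasWeight m v)
    (hv0 : v ≠ 0) {ι : Type*} {n : ι → MaximalSpectrum R} {g : ι → V}
    (hg : ∀ i, HasWeight (n i) (g i)) (h : v ∈ Submodule.span R (Set.range g)) :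
    ∃ i, n i = m := by
  obtain ⟨c, rfl⟩ := (Finsupp.mem_span_range_iff_exists_finsupp).mp h
  have hle : ∏ i ∈ c.support, (n i).asIdeal ≤ m.asIdeal := by
    intro r hr
    refine hv.mem_of_smul_eq_zero hv0 ?_
    rw [Finsupp.sum, Finset.smul_sum]
    refine Finset.sum_eq_zero fun i hi => ?_
    rw [smul_comm, hg i r (Ideal.le_of_dvd (Finset.dvd_prod_of_mem _ hi) hr), smul_zero]
  obtain ⟨i, -, hi⟩ := (Ideal.IsPrime.prod_le m.isMaximal.isPrime).mp hle
  exact ⟨i, MaximalSpectrum.ext ((n i).isMaximal.eq_of_le m.isMaximal.ne_top hi)⟩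

/-- An injective operator with `r y = y σ(r)` on an Artinian module has weights which are periodic
under `𝔪 ↦ σ⁻¹(𝔪)`. -/
theorem exists_periodic_weight (hσ : IsEssential σ) [IsArtinian R V] [Nontrivial V] (y : V →+ V)
    (hy : ∀ (r : R) v, r • y v = y (σ r • v)) (hinj : Function.Injective y) :
    ∃ (m : MaximalSpectrum R) (v : V), HasWeight m v ∧ v ≠ 0 ∧
      ∃ k, 0 < k ∧ (lower hσ)^[k] m = m := by
  obtain ⟨w, -, hw0, m, hw⟩ := exists_hasWeight (R := R) (V := V) (U := ⊤) top_ne_bot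
  let c : ℕ →o (Submodule R V)ᵒᵈ :=
    { toFun := fun n => OrderDual.toDual (Submodule.span R (Set.range fun b => y^[n + b] w))
      monotone' := monotone_nat_of_le_succ fun n => by
        refine Submodule.span_mono ?_
        rintro _ ⟨b, rfl⟩
        exact ⟨b + 1, by simp only [add_assoc, add_comm 1 b]⟩ }
  obtain ⟨n, hn⟩ := IsArtinian.monotone_stabilizes c
  have h1 : y^[n] w ∈ OrderDual.ofDual (c n) := Submodule.subset_span ⟨0, rfl⟩
  rw [hn (n + 1) (Nat.le_succ n)] at h1
  have hwt := fun j => hw.iterate hσ (map_zero y) hy j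
  have hne : y^[n] w ≠ 0 := fun h =>
    hw0 (hinj.iterate n (h.trans (Function.iterate_fixed (map_zero y) n).symm))
  obtain ⟨b, hb⟩ := (hwt n).exists_eq_of_mem_span hne (fun b => hwt (n + 1 + b)) h1
  refine ⟨_, _, hwt n, hne, b + 1, Nat.succ_pos b, ?_⟩
  rw [← Function.iterate_add_apply]
  exact (congrArg (fun j => (lower hσ)^[j] m) (by omega)).trans hb

/-- A maximal ideal periodic under `𝔪 ↦ σ⁻¹(𝔪)` extends to a periodic sequence
`𝔪_i = (σ⁻¹)⁻ⁱ(𝔪)`. -/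
theorem exists_bandSeq (hσ : IsEssential σ) {m : MaximalSpectrum R} {k : ℕ} (hk : 0 < k)
    (hm : (lower hσ)^[k] m = m) : ∃ b : BandSeq σ, b.m 0 = m := by
  have hpos : 0 < Function.minimalPeriod (lower hσ) m :=
    Function.IsPeriodicPt.minimalPeriod_pos hk hm
  obtain ⟨p, hp⟩ : ∃ p, p = Function.minimalPeriod (lower hσ) m := ⟨_, rfl⟩
  rw [← hp] at hpos
  -- The exponent `-i` matters only modulo `p`; any natural number `n ≡ -i` serves as well.
  have key : ∀ (i : ℤ) (n : ℕ), ((n : ℤ) + i) % p = 0 →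
      (lower hσ)^[((-i) % p).toNat] m = (lower hσ)^[n] m := by
    intro i n h
    rw [← Function.iterate_mod_minimalPeriod_eq (n := n), ← hp]
    have h1 : (n : ℤ) % p = (-i) % p := by
      rw [Int.emod_eq_emod_iff_emod_sub_eq_zero, sub_neg_eq_add, h]
    rw [← h1, ← Int.natCast_mod, Int.toNat_natCast]
  refine ⟨{
    m := fun i => (lower hσ)^[((-i) % p).toNat] m
    chain := fun i => ?_
    d := p - 1
    period := ⟨⟨by omega, fun i => ?_⟩, fun j hj => ?_⟩ }, by simp⟩
  · have h := key i (((-(i + 1)) % (p : ℤ)).toNat + 1) (by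
      have h0 : 0 ≤ (-(i + 1)) % (p : ℤ) := Int.emod_nonneg _ (by omega)
      have h2 : ((((-(i + 1)) % (p : ℤ)).toNat + 1 : ℕ) : ℤ) + i =
          (-(i + 1)) % (p : ℤ) - (-(i + 1)) := by push_cast; omega
      rw [h2, ← Int.emod_eq_emod_iff_emod_sub_eq_zero, Int.emod_emod])
    simp only [h, Function.iterate_succ_apply']
    exact below_lower hσ _
  · have h : (p - 1 + 1 : ℕ) = p := by omega
    rw [h]
    have h2 : (-(i + (p : ℤ))) % p = (-i) % p := by
      rw [Int.emod_eq_emod_iff_emod_sub_eq_zero]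
      simp
    rw [h2]
  · have h := hj.2 (-(j : ℤ))
    have h2 := key (-(j : ℤ)) j (by simp)
    simp only [neg_add_cancel, neg_zero, Int.zero_emod, Int.toNat_zero, Function.iterate_zero,
      id_eq] at h
    rw [h2] at h
    have := Function.IsPeriodicPt.minimalPeriod_le hj.1 h.symm
    omega

theorem HasWeight.map_of_below {m n : MaximalSpectrum R} (hnm : Below σ n m) {y : V → V}
    (hy0 : y 0 = 0) (hy : ∀ (r : R) v, r • y v = y (σ r • v)) {v : V} (h : HasWeight m v) :
    HasWeight n (y v) := fun r hr => by rw [hy, h (σ r) (hnm hr), hy0]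

theorem HasWeight.iterate_bandSeq (b : BandSeq σ) {y : V → V} (hy0 : y 0 = 0)
    (hy : ∀ (r : R) v, r • y v = y (σ r • v)) {i : ℤ} {v : V} (h : HasWeight (b.m i) v) (n : ℕ) :
    HasWeight (b.m (i - n)) (y^[n] v) := by
  induction n with
  | zero => simpa using h
  | succ n ih =>
    rw [Function.iterate_succ_apply']
    have hb := b.chain (i - (n + 1 : ℕ))
    have he : i - ((n + 1 : ℕ) : ℤ) + 1 = i - n := by push_cast; ring
    rw [he] at hb
    exact ih.map_of_below hb hy0 hy

end Cycles

/-! ### Modules over skew Laurent polynomials inside weight spaces -/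

section Laurent

variable (hσ : IsEssential σ) (b : BandSeq σ)

/-- `𝕜` carries only a ring structure, so that it being a field takes this form. -/
theorem BandSeq.isUnit_of_ne_zero (c : b.K hσ) (hc : c ≠ 0) : IsUnit c := by
  let _ := Ideal.Quotient.field (b.m 0).asIdeal
  obtain ⟨d, hd⟩ : ∃ d : b.K hσ, c * d = 1 :=
    ⟨(c⁻¹ : R ⧸ (b.m 0).asIdeal), @mul_inv_cancel₀ (R ⧸ (b.m 0).asIdeal) _ c hc⟩
  exact IsUnit.of_mul_eq_one d hd

instance : IsDomain (b.K hσ) := inferInstanceAs (IsDomain (R ⧸ (b.m 0).asIdeal))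

variable {hσ b} {L : Type v} [AddCommGroup L] [Module (b.K hσ) L]

/-- The powers of a `σ̄`-semilinear bijection are semilinear for the powers of `σ̄`. -/
theorem BandSeq.zpow_apply_smul (E : (AddMonoid.End L)ˣ)
    (hE : ∀ (c : b.K hσ) x, E.val (c • x) = b.sigmaBar hσ c • E.val x) (n : ℤ) (c : b.K hσ)
    (x : L) : (E ^ n).val (c • x) = (Multiplicative.ofAdd n • c) • (E ^ n).val x := by
  have hs : Multiplicative.ofAdd n • c = (b.sigmaBar hσ ^ n) c := by
    change (zpowersHom (RingAut (b.K hσ)) (b.sigmaBar hσ) (Multiplicative.ofAdd n)) c = _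
    rw [zpowersHom_apply]
    rfl
  have hE' : ∀ (c : b.K hσ) x, E⁻¹.val (c • x) = (b.sigmaBar hσ)⁻¹ c • E⁻¹.val x := by
    intro c x
    have h1 : ∀ y, E.val (E⁻¹.val y) = y := DFunLike.congr_fun E.mul_inv
    have h2 : ∀ y, E⁻¹.val (E.val y) = y := DFunLike.congr_fun E.inv_mul
    have h3 : b.sigmaBar hσ ((b.sigmaBar hσ)⁻¹ c) = c := (b.sigmaBar hσ).apply_symm_apply c
    rw [← h2 ((b.sigmaBar hσ)⁻¹ c • E⁻¹.val x), hE, h1, h3]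
  rw [hs]
  clear hs
  induction n generalizing c x with
  | zero => rfl
  | succ n ih =>
    rw [zpow_add_one, zpow_add_one]
    change (E ^ (n : ℤ)).val (E.val (c • x)) =
      (b.sigmaBar hσ ^ (n : ℤ)) (b.sigmaBar hσ c) • (E ^ (n : ℤ)).val (E.val x)
    rw [hE, ih]
  | pred n ih =>
    rw [zpow_sub_one, zpow_sub_one]
    change (E ^ (-n : ℤ)).val (E⁻¹.val (c • x)) =
      (b.sigmaBar hσ ^ (-n : ℤ)) ((b.sigmaBar hσ)⁻¹ c) • (E ^ (-n : ℤ)).val (E⁻¹.val x)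
    rw [hE', ih]

/-- The action of `𝐏` on a vector space over `𝕜` on which `α` acts by the `σ̄`-semilinear
bijection `E`. -/
noncomputable def BandSeq.laurentHom (E : (AddMonoid.End L)ˣ)
    (hE : ∀ (c : b.K hσ) x, E.val (c • x) = b.sigmaBar hσ c • E.val x) :
    b.P hσ →+* AddMonoid.End L :=
  SkewMonoidAlgebra.liftNCRingHom (Module.toAddMonoidEnd (b.K hσ) L)
    ((Units.coeHom (AddMonoid.End L)).comp (zpowersHom (AddMonoid.End L)ˣ E))
    (fun {x y} => AddMonoidHom.ext fun l => (b.zpow_apply_smul E hE y.toAdd x l).symm)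

theorem BandSeq.laurentHom_const (E : (AddMonoid.End L)ˣ)
    (hE : ∀ (c : b.K hσ) x, E.val (c • x) = b.sigmaBar hσ c • E.val x) (c : b.K hσ) (x : L) :
    b.laurentHom E hE (b.const hσ c) x = c • x := by
  have h : b.laurentHom E hE (b.const hσ c) = Module.toAddMonoidEnd (b.K hσ) L c *
      ((Units.coeHom (AddMonoid.End L)).comp (zpowersHom (AddMonoid.End L)ˣ E)) 1 :=
    SkewMonoidAlgebra.liftNC_single _ _ _ _
  rw [h, map_one, mul_one]
  rfl

theorem BandSeq.laurentHom_alpha (E : (AddMonoid.End L)ˣ)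
    (hE : ∀ (c : b.K hσ) x, E.val (c • x) = b.sigmaBar hσ c • E.val x) (x : L) :
    b.laurentHom E hE (b.alpha hσ) x = E.val x := by
  have h : b.laurentHom E hE (b.alpha hσ) = Module.toAddMonoidEnd (b.K hσ) L 1 *
      ((Units.coeHom (AddMonoid.End L)).comp (zpowersHom (AddMonoid.End L)ˣ E))
        (Multiplicative.ofAdd 1) :=
    SkewMonoidAlgebra.liftNC_single _ _ _ _
  rw [h, map_one, one_mul]
  change (E ^ (1 : ℤ)).val x = _
  rw [zpow_one]

end Laurent

section WeightSpace

variable {V : Type v} [AddCommGroup V] [Module R V]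

/-- The weight space of `𝔪_0` as a vector space over `𝕜`. -/
noncomputable abbrev BandSeq.weightSpaceModule (b : BandSeq σ) (hσ : IsEssential σ) (V : Type v)
    [AddCommGroup V] [Module R V] :
    Module (b.K hσ) (Submodule.torsionBySet R V (b.m 0).asIdeal) :=
  inferInstanceAs (Module (R ⧸ (b.m 0).asIdeal) (Submodule.torsionBySet R V (b.m 0).asIdeal))

/-- Inside the weight space of `𝔪_0`, on which `yᵏ` is bijective, there is a copy of some `L_f` on
which `α` acts as the inverse of `yᵏ`. -/
theorem exists_quotient_to_weightSpace (hσ : IsEssential σ) (b : BandSeq σ) [IsArtinian R V]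
    [IsNoetherian R V] (y : V →+ V) (hy : ∀ (r : R) v, r • y v = y (σ r • v))
    (hinj : Function.Injective y) {v : V} (hv : HasWeight (b.m 0) v) (hv0 : v ≠ 0) :
    ∃ f : b.P hσ, Irreducible f ∧ ∃ φ : b.L hσ f →+ V, (∃ x, φ x ≠ 0) ∧
      (∀ x, HasWeight (b.m 0) (φ x)) ∧
      (∀ r x, φ (b.const hσ (b.red hσ r) • x) = r • φ x) ∧
      ∀ x, y^[b.d + 1] (φ ((b.alpha hσ : b.P hσ) • x)) = φ x := by
  let L := Submodule.torsionBySet R V (b.m 0).asIdeal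
  have hmem : ∀ v, v ∈ L ↔ HasWeight (b.m 0) v := fun v => by
    rw [Submodule.mem_torsionBySet_iff]
    exact ⟨fun h r hr => h ⟨r, hr⟩, fun h r => h r r.2⟩
  have hyL : ∀ l ∈ L, y^[b.d + 1] l ∈ L := by
    intro l hl
    rw [hmem] at hl ⊢
    have := hl.iterate_bandSeq b (map_zero y) hy (b.d + 1)
    have h2 := b.period.1.2 (0 - (b.d + 1 : ℕ))
    rw [sub_add_cancel] at h2
    rwa [← h2] at this
  let yk : L →+ L :=
    { toFun := fun l => ⟨y^[b.d + 1] l, hyL l l.2⟩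
      map_zero' := Subtype.ext (Function.iterate_fixed (map_zero y) _)
      map_add' := fun l l' => Subtype.ext (iterate_map_add y _ _ _) }
  have hyk : ∀ (r : R) l, r • yk l = yk ((σ ^ (b.d + 1)) r • l) := fun r l =>
    Subtype.ext (smul_iterate_of_twisted σ y hy _ r l)
  have hykinj : Function.Injective yk := fun l l' h =>
    Subtype.ext (hinj.iterate (b.d + 1) (congrArg Subtype.val h))
  let e := AddEquiv.ofBijective yk
    ⟨hykinj, surjective_of_injective_of_isArtinian (σ ^ (b.d + 1)) yk hyk hykinj⟩
  have he : ∀ l, e l = yk l := fun _ => rfl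
  let E : (AddMonoid.End L)ˣ := ⟨e.symm.toAddMonoidHom, e.toAddMonoidHom,
    AddMonoidHom.ext e.symm_apply_apply, AddMonoidHom.ext e.apply_symm_apply⟩
  have hEe : ∀ l, E.val l = e.symm l := fun _ => rfl
  let _ : Module (b.K hσ) L := b.weightSpaceModule hσ V
  have hred : ∀ (r : R) (l : L), b.red hσ r • l = r • l := fun _ _ => rfl
  have hE : ∀ (c : b.K hσ) x, E.val (c • x) = b.sigmaBar hσ c • E.val x := by
    intro c x
    obtain ⟨r, rfl⟩ := b.red_surjective hσ c
    rw [b.sigmaBar_red, hred, hred, hEe, hEe, AddEquiv.symm_apply_eq, he, ← hyk, ← he,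
      AddEquiv.apply_symm_apply]
  let _ : Module (b.P hσ) L := Module.compHom L (b.laurentHom E hE)
  have hconst : ∀ (c : b.K hσ) (x : L), b.const hσ c • x = c • x := b.laurentHom_const E hE
  have halpha : ∀ x : L, (b.alpha hσ : b.P hσ) • x = E.val x := b.laurentHom_alpha E hE
  let _ : Algebra R (b.K hσ) := (b.red hσ).toAlgebra
  have : IsScalarTower R (b.K hσ) L := ⟨fun r c x => by
    obtain ⟨s, rfl⟩ := b.red_surjective hσ c
    rw [Algebra.smul_def]
    change (b.red hσ r * b.red hσ s) • x = _
    rw [← map_mul, hred, hred, mul_smul]⟩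
  have : IsNoetherian (b.K hσ) L := isNoetherian_of_tower R inferInstance
  have : IsArtinian (b.K hσ) L := isArtinian_of_tower R inferInstance
  have : Nontrivial L := ⟨⟨v, (hmem v).mpr hv⟩, 0, fun h => hv0 (congrArg Subtype.val h)⟩
  obtain ⟨f, hf, l, hl0, hl⟩ := SkewLaurent.exists_irreducible_smul_eq_zero
    (b.isUnit_of_ne_zero (hσ := hσ)) (L := L) hconst
  let ψ : b.L hσ f →ₗ[b.P hσ] L := Submodule.liftQ _ (LinearMap.toSpanSingleton (b.P hσ) L l)
    (by
      rw [Submodule.span_singleton_le_iff_mem]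
      exact hl)
  refine ⟨f, hf, L.subtype.toAddMonoidHom.comp ψ.toAddMonoidHom,
    ⟨Submodule.Quotient.mk 1, ?_⟩, fun x => (hmem _).mp (ψ x).2, fun r x => ?_, fun x => ?_⟩
  · intro h
    refine hl0 (Subtype.ext ?_)
    have h1 : ψ (Submodule.Quotient.mk 1) = (1 : b.P hσ) • l := rfl
    rw [one_smul] at h1
    rw [← h1]
    exact h
  · change ((ψ (b.const hσ (b.red hσ r) • x) : L) : V) = r • ((ψ x : L) : V)
    rw [map_smul, hconst, hred]
    rfl
  · change y^[b.d + 1] ((ψ ((b.alpha hσ : b.P hσ) • x) : L) : V) = ((ψ x : L) : V)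
    rw [map_smul, halpha, hEe]
    exact congrArg Subtype.val (e.apply_symm_apply (ψ x))

end WeightSpace

/-! ### The operators of a band module -/

section BandOperators

variable {hσ : IsEssential σ} {b : BandSeq σ} {f : b.P hσ}

theorem BandM.coef_smul (r : R) (v : BandM hσ t b f) :
    coef σ t r • v = twist (bandCoefM hσ b) r v := by
  change (bandRepM hσ t b f).toHom (coef σ t r) v = _
  exact DFunLike.congr_fun ((bandRepM hσ t b f).toHom_coef r) v

theorem BandM.Y_smul (v : BandM hσ t b f) :
    Y σ t • v = shift b.d (b.alpha hσ)⁻¹ v := by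
  change (bandRepM hσ t b f).toHom (Y σ t) v = _
  exact DFunLike.congr_fun (bandRepM hσ t b f).toHom_Y v

theorem BandN.coef_smul (r : R) (v : BandN hσ t b f) :
    coef σ t r • v = twist (bandCoefN hσ b) r v := by
  change (bandRepN hσ t b f).toHom (coef σ t r) v = _
  exact DFunLike.congr_fun ((bandRepN hσ t b f).toHom_coef r) v

theorem BandN.X_smul (v : BandN hσ t b f) :
    X σ t • v = shift b.d (b.alpha hσ) v := by
  change (bandRepN hσ t b f).toHom (X σ t) v = _
  exact DFunLike.congr_fun (bandRepN hσ t b f).toHom_X v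

theorem BandM.coef_smul_apply (r : R) (v : BandM hσ t b f) (i : Fin (b.d + 1)) :
    (coef σ t r • v) i = bandCoefM hσ b i r • v i := by
  rw [BandM.coef_smul]
  rfl

theorem BandM.Y_smul_zero (v : BandM hσ t b f) :
    (Y σ t • v) 0 = (((b.alpha hσ)⁻¹ : (b.P hσ)ˣ) : b.P hσ) • v (Fin.last b.d) := by
  rw [BandM.Y_smul]
  rfl

theorem BandM.Y_smul_succ (v : BandM hσ t b f) (i : Fin b.d) :
    (Y σ t • v) i.succ = v i.castSucc := by
  rw [BandM.Y_smul]
  rfl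

theorem BandN.coef_smul_apply (r : R) (v : BandN hσ t b f) (i : Fin (b.d + 1)) :
    (coef σ t r • v) i = bandCoefN hσ b i r • v i := by
  rw [BandN.coef_smul]
  rfl

theorem BandN.X_smul_zero (v : BandN hσ t b f) :
    (X σ t • v) 0 = (b.alpha hσ : b.P hσ) • v (Fin.last b.d) := by
  rw [BandN.X_smul]
  rfl

theorem BandN.X_smul_succ (v : BandN hσ t b f) (i : Fin b.d) :
    (X σ t • v) i.succ = v i.castSucc := by
  rw [BandN.X_smul]
  rfl

variable {V : Type v} [AddCommGroup V] [Module R V] [Module (WGWA σ t) V]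

/-- If `Y` is injective and `α⁻¹` acts on a copy of `L_f` in `V` as `Yᵏ`, then
`v ↦ ∑ Yⁱ φ(vᵢ)` is a homomorphism from `M^f`. -/
theorem exists_linearMap_bandM (hc : ∀ (r : R) (v : V), coef σ t r • v = r • v)
    (φ : b.L hσ f →+ V) (hφ : ∀ r x, φ (b.const hσ (b.red hσ r) • x) = r • φ x)
    (hα : ∀ x, (opY σ t V)^[b.d + 1] (φ ((b.alpha hσ : b.P hσ) • x)) = φ x) (hne : ∃ x, φ x ≠ 0) :
    ∃ G : BandM hσ t b f →ₗ[WGWA σ t] V, G ≠ 0 := by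
  let F : BandM hσ t b f →+ V :=
    { toFun := fun v => ∑ i : Fin (b.d + 1), (opY σ t V)^[i] (φ (v i))
      map_zero' := Finset.sum_eq_zero fun i _ => by
        change (opY σ t V)^[i] (φ 0) = 0
        rw [map_zero, Function.iterate_fixed (map_zero _)]
      map_add' := fun v w => by
        rw [← Finset.sum_add_distrib]
        refine Finset.sum_congr rfl fun i _ => ?_
        change (opY σ t V)^[i] (φ (v i + w i)) = _
        rw [map_add, iterate_map_add] }
  have hF : ∀ v : BandM hσ t b f, F v = ∑ i : Fin (b.d + 1), (opY σ t V)^[i] (φ (v i)) :=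
    fun _ => rfl
  have hY : ∀ v, F (Y σ t • v) = Y σ t • F v := by
    intro v
    have h1 : Y σ t • F v = opY σ t V (∑ i : Fin (b.d + 1), (opY σ t V)^[i] (φ (v i))) := rfl
    rw [h1, hF, Fin.sum_univ_succ, map_sum, Fin.sum_univ_castSucc, add_comm, BandM.Y_smul_zero]
    congr 1
    · exact Finset.sum_congr rfl fun i _ => by
        rw [BandM.Y_smul_succ, ← Function.iterate_succ_apply' (opY σ t V)]
        rfl
    rw [← Function.iterate_succ_apply' (opY σ t V)]
    have h2 := hα ((((b.alpha hσ)⁻¹ : (b.P hσ)ˣ) : b.P hσ) • v (Fin.last b.d))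
    rw [smul_smul, Units.mul_inv, one_smul] at h2
    exact h2.symm
  have hcoef : ∀ r v, F (coef σ t r • v) = coef σ t r • F v := by
    intro r v
    rw [hc, hF, hF, Finset.smul_sum]
    refine Finset.sum_congr rfl fun i _ => ?_
    rw [BandM.coef_smul_apply, smul_iterate_of_twisted σ _ (smul_opY hc), ← hφ]
    rfl
  refine ⟨linearMapOfCommute F hcoef (fun v => ?_) hY, ?_⟩
  -- `Y` is onto on `M^f`, so that `X` is determined by `XY = σ(t)`.
  · obtain ⟨w, hw⟩ : ∃ w : BandM hσ t b f, Y σ t • w = v := by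
      obtain ⟨w, hw⟩ := (shift b.d (b.alpha hσ)⁻¹ : _ ≃+ (Fin (b.d + 1) → b.L hσ f)).surjective v
      exact ⟨w, (BandM.Y_smul w).trans hw⟩
    rw [← hw, ← mul_smul, X_mul_Y, hcoef, hY, ← mul_smul, X_mul_Y]
  · intro h
    obtain ⟨x, hx⟩ := hne
    refine hx ?_
    have h1 := hF (Pi.single (M := fun _ : Fin (b.d + 1) => b.L hσ f) 0 x)
    rw [Finset.sum_eq_single 0, Pi.single_eq_same] at h1
    · exact h1.symm.trans (LinearMap.congr_fun h _)
    · intro i _ hi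
      rw [Pi.single_eq_of_ne hi, map_zero, Function.iterate_fixed (map_zero _)]
    · exact fun h => absurd (Finset.mem_univ _) h

/-- If `X` is bijective with inverse `z`, and `α` acts on a copy of `L_f` in `V` as `Xᵏ`, then
`v ↦ ∑ Xⁱ φ(vᵢ)` is a homomorphism from `N^f`. -/
theorem exists_linearMap_bandN (hc : ∀ (r : R) (v : V), coef σ t r • v = r • v) (z : V →+ V)
    (hz : ∀ (r : R) v, r • z v = z (σ r • v)) (hzX : ∀ v, z (opX σ t V v) = v)
    (hXz : ∀ v, opX σ t V (z v) = v)
    (φ : b.L hσ f →+ V) (hφ : ∀ r x, φ (b.const hσ (b.red hσ r) • x) = r • φ x)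
    (hφm : ∀ x, HasWeight (b.m 0) (φ x))
    (hα : ∀ x, z^[b.d + 1] (φ ((b.alpha hσ : b.P hσ) • x)) = φ x) (hne : ∃ x, φ x ≠ 0) :
    ∃ G : BandN hσ t b f →ₗ[WGWA σ t] V, G ≠ 0 := by
  let F : BandN hσ t b f →+ V :=
    { toFun := fun v => ∑ i : Fin (b.d + 1), (opX σ t V)^[i] (φ (v i))
      map_zero' := Finset.sum_eq_zero fun i _ => by
        change (opX σ t V)^[i] (φ 0) = 0
        rw [map_zero, Function.iterate_fixed (map_zero _)]
      map_add' := fun v w => by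
        rw [← Finset.sum_add_distrib]
        refine Finset.sum_congr rfl fun i _ => ?_
        change (opX σ t V)^[i] (φ (v i + w i)) = _
        rw [map_add, iterate_map_add] }
  have hF : ∀ v : BandN hσ t b f, F v = ∑ i : Fin (b.d + 1), (opX σ t V)^[i] (φ (v i)) :=
    fun _ => rfl
  have hzXn : ∀ n v, z^[n] ((opX σ t V)^[n] v) = v :=
    fun n => (show Function.LeftInverse z (opX σ t V) from hzX).iterate n
  have hXzn : ∀ n v, (opX σ t V)^[n] (z^[n] v) = v :=
    fun n => (show Function.LeftInverse (opX σ t V) z from hXz).iterate n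
  have hα' : ∀ x, (opX σ t V)^[b.d + 1] (φ x) = φ ((b.alpha hσ : b.P hσ) • x) := by
    intro x
    rw [← hα x, hXzn]
  -- `Xⁱφ(x) = X⁻⁽ᵏ⁻ⁱ⁾φ(αx)`, and `X⁻¹` moves weights along the cycle.
  have hwt : ∀ (i : Fin (b.d + 1)) x, HasWeight (b.m (i : ℕ)) ((opX σ t V)^[i] (φ x)) := by
    intro i x
    have hi : b.d + 1 = (b.d + 1 - i) + i := by omega
    have h1 : (opX σ t V)^[i] (φ x) = z^[b.d + 1 - i] (φ ((b.alpha hσ : b.P hσ) • x)) := by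
      rw [← hα', ← hzXn (b.d + 1 - i) ((opX σ t V)^[i] (φ x)), ← Function.iterate_add_apply, ← hi]
    have h2 := (hφm ((b.alpha hσ : b.P hσ) • x)).iterate_bandSeq b (map_zero z) hz (b.d + 1 - i)
    rw [← h1, ← b.period.1.2] at h2
    convert h2 using 2
    omega
  have hXn : ∀ (n : ℕ) (r : R) v, (opX σ t V)^[n] (r • v) = (σ ^ n) r • (opX σ t V)^[n] v := by
    intro n
    induction n with
    | zero => exact fun _ _ => rfl
    | succ n ih =>
      intro r v
      rw [Function.iterate_succ_apply', ih, Function.iterate_succ_apply', pow_succ']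
      exact X_smul_smul hc _ _
  have hX : ∀ v, F (X σ t • v) = X σ t • F v := by
    intro v
    have h1 : X σ t • F v = opX σ t V (∑ i : Fin (b.d + 1), (opX σ t V)^[i] (φ (v i))) := rfl
    rw [h1, hF, Fin.sum_univ_succ, map_sum, Fin.sum_univ_castSucc, add_comm, BandN.X_smul_zero]
    congr 1
    · exact Finset.sum_congr rfl fun i _ => by
        rw [BandN.X_smul_succ, ← Function.iterate_succ_apply' (opX σ t V)]
        rfl
    rw [← Function.iterate_succ_apply' (opX σ t V)]
    exact (hα' (v (Fin.last b.d))).symm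
  have hcoef : ∀ r v, F (coef σ t r • v) = coef σ t r • F v := by
    intro r v
    rw [hc, hF, hF, Finset.smul_sum]
    refine Finset.sum_congr rfl fun i _ => ?_
    obtain ⟨s, hs⟩ := b.surj_pow hσ i r
    rw [BandN.coef_smul_apply, ← bandCoefN_congr hσ b i hs, bandCoefN_pow, hφ, hXn,
      (hwt i _).smul_congr hs]
  refine ⟨linearMapOfCommute F hcoef hX (fun v => ?_), ?_⟩
  -- `X` is onto on `N^f`, so that `Y` is determined by `YX = t`.
  · obtain ⟨w, hw⟩ : ∃ w : BandN hσ t b f, X σ t • w = v := by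
      obtain ⟨w, hw⟩ := (shift b.d (b.alpha hσ) : _ ≃+ (Fin (b.d + 1) → b.L hσ f)).surjective v
      exact ⟨w, (BandN.X_smul w).trans hw⟩
    rw [← hw, ← mul_smul, Y_mul_X, hcoef, hX, ← mul_smul, Y_mul_X]
  · intro h
    obtain ⟨x, hx⟩ := hne
    refine hx ?_
    have h1 := hF (Pi.single (M := fun _ : Fin (b.d + 1) => b.L hσ f) 0 x)
    rw [Finset.sum_eq_single 0, Pi.single_eq_same] at h1
    · exact h1.symm.trans (LinearMap.congr_fun h _)
    · intro i _ hi
      rw [Pi.single_eq_of_ne hi, map_zero, Function.iterate_fixed (map_zero _)]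
    · exact fun h => absurd (Finset.mem_univ _) h

end BandOperators

/-! ### Simplicity of the band modules -/

section BandSimple

theorem BandSeq.pow_mem (b : BandSeq σ) {i : ℤ} {r : R} (hr : r ∈ (b.m i).asIdeal) (n : ℕ) :
    (σ ^ n) r ∈ (b.m (i + n)).asIdeal := by
  induction n with
  | zero => simpa using hr
  | succ n ih =>
    have h := b.chain _ ih
    rw [pow_succ']
    push_cast
    rw [← add_assoc]
    exact h

/-- By minimality of the period, `𝔪_i = 𝔪_j` with `i < j` forces `j - i ≥ k`. -/
theorem BandSeq.period_le_sub (hσ : IsEssential σ) (b : BandSeq σ) {i j : ℤ} (hij : i < j)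
    (h : b.m i = b.m j) : (b.d : ℤ) + 1 ≤ j - i := by
  have hdown : ∀ l : ℕ, b.m (i - l) = b.m (j - l) := by
    intro l
    induction l with
    | zero => simpa using h
    | succ l ih =>
      have h1 := b.chain (i - (l + 1 : ℕ))
      have h2 := b.chain (j - (l + 1 : ℕ))
      have e1 : i - ((l + 1 : ℕ) : ℤ) + 1 = i - l := by push_cast; ring
      have e2 : j - ((l + 1 : ℕ) : ℤ) + 1 = j - l := by push_cast; ring
      rw [e1] at h1
      rw [e2] at h2
      rw [h1.eq_lower hσ, h2.eq_lower hσ, ih]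
  have hper : ∀ (x : ℤ) (N : ℕ), b.m (x - N * (b.d + 1 : ℕ)) = b.m x := by
    intro x N
    induction N with
    | zero => simp
    | succ N ih =>
      rw [← ih, ← b.period.1.2 (x - (N + 1 : ℕ) * (b.d + 1 : ℕ))]
      congr 1
      push_cast
      ring
  -- The sequence is determined to the left of `i` and `j`, and by periodicity everywhere.
  have hmem : (j - i).toNat ∈ {k : ℕ | 0 < k ∧ ∀ i : ℤ, b.m (i + k) = b.m i} := by
    refine ⟨by omega, fun x => ?_⟩
    have hle : x - ((x - i).toNat : ℤ) * (b.d + 1 : ℕ) ≤ i := by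
      have h1 : ((x - i).toNat : ℤ) ≤ ((x - i).toNat : ℤ) * (b.d + 1 : ℕ) :=
        le_mul_of_one_le_right (by positivity) (by push_cast; omega)
      have h2 := Int.self_le_toNat (x - i)
      omega
    obtain ⟨l, hl⟩ := Int.eq_ofNat_of_zero_le (sub_nonneg.mpr hle)
    have h1 := hdown l
    rw [← hper (x + ((j - i).toNat : ℤ)) (x - i).toNat, ← hper x (x - i).toNat]
    have e1 : i - (l : ℤ) = x - ((x - i).toNat : ℤ) * (b.d + 1 : ℕ) := by
      rw [show (l : ℤ) = _ from hl.symm]; ring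
    have e2 : j - (l : ℤ) = x + ((j - i).toNat : ℤ) - ((x - i).toNat : ℤ) * (b.d + 1 : ℕ) := by
      have : ((j - i).toNat : ℤ) = j - i := Int.toNat_of_nonneg (by omega)
      rw [this]
      linear_combination e1
    rw [e1, e2] at h1
    exact h1.symm
  have := b.period.2 hmem
  omega

variable {hσ : IsEssential σ} {b : BandSeq σ}

/-- `𝐏` is generated by `𝕜`, `α` and `α⁻¹`. -/
theorem BandSeq.smul_mem_of_stable {L : Type*} [AddCommGroup L] [Module (b.P hσ) L]
    (U : AddSubgroup L) (hk : ∀ k, ∀ l ∈ U, b.const hσ k • l ∈ U)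
    (hα : ∀ l ∈ U, (b.alpha hσ : b.P hσ) • l ∈ U)
    (hα' : ∀ l ∈ U, (((b.alpha hσ)⁻¹ : (b.P hσ)ˣ) : b.P hσ) • l ∈ U) (p : b.P hσ) :
    ∀ l ∈ U, p • l ∈ U := by
  have hpow : ∀ n : ℤ, ∀ l ∈ U, ((b.alpha hσ ^ n : (b.P hσ)ˣ) : b.P hσ) • l ∈ U := by
    intro n
    induction n with
    | zero => intro l hl; simpa using hl
    | succ n ih =>
      intro l hl
      rw [zpow_add_one, Units.val_mul, mul_smul]
      exact ih _ (hα l hl)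
    | pred n ih =>
      intro l hl
      rw [zpow_sub_one, Units.val_mul, mul_smul]
      exact ih _ (hα' l hl)
  have hsingle : ∀ n : ℤ, ((b.alpha hσ ^ n : (b.P hσ)ˣ) : b.P hσ) =
      SkewMonoidAlgebra.single (Multiplicative.ofAdd n) 1 := by
    intro n
    induction n with
    | zero => rfl
    | succ n ih =>
      rw [zpow_add_one, Units.val_mul, ih]
      change _ * SkewMonoidAlgebra.single (Multiplicative.ofAdd (1 : ℤ)) (1 : b.K hσ) = _
      rw [SkewMonoidAlgebra.single_mul_single, smul_one, mul_one, ← ofAdd_add]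
    | pred n ih =>
      rw [zpow_sub_one, Units.val_mul, ih]
      change _ * SkewMonoidAlgebra.single (Multiplicative.ofAdd (-1 : ℤ)) (1 : b.K hσ) = _
      rw [SkewMonoidAlgebra.single_mul_single, smul_one, mul_one, ← ofAdd_add]
      rfl
  induction p using SkewMonoidAlgebra.induction_on with
  | zero => intro l _; rw [zero_smul]; exact U.zero_mem
  | single g k =>
    intro l hl
    have h : (SkewMonoidAlgebra.single g k : b.P hσ) =
        b.const hσ k * ((b.alpha hσ ^ g.toAdd : (b.P hσ)ˣ) : b.P hσ) := by
      rw [hsingle]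
      change _ = SkewMonoidAlgebra.single 1 k * _
      rw [SkewMonoidAlgebra.single_mul_single]
      simp
    rw [h, mul_smul]
    exact hk _ _ (hpow _ _ hl)
  | add p q hp hq => intro l hl; rw [add_smul]; exact U.add_mem (hp l hl) (hq l hl)

instance (b : BandSeq σ) (hσ : IsEssential σ) : IsArtinianRing (b.K hσ) := by
  let _ := Ideal.Quotient.field (b.m 0).asIdeal
  exact inferInstanceAs (IsArtinianRing (R ⧸ (b.m 0).asIdeal))

theorem BandSeq.smul_mk (f : b.P hσ) (k : b.K hσ) (x : b.L hσ f) :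
    k • x = b.const hσ k • x := by
  obtain ⟨p, rfl⟩ := Submodule.Quotient.mk_surjective _ x
  rw [← Submodule.Quotient.mk_smul, ← Submodule.Quotient.mk_smul]
  congr 1
  ext i
  change (k • p).coeff i = (SkewMonoidAlgebra.single 1 k * p).coeff i
  simp

/-- `L_f` is finite-dimensional over `𝕜`, spanned by finitely many powers of `α`. -/
theorem BandSeq.exists_generators (f : b.P hσ) (hf : f ≠ 0) :
    ∃ (w : ℕ) (g : Fin w → b.L hσ f), ∀ x, ∃ k : Fin w → b.K hσ,
      x = ∑ j, b.const hσ (k j) • g j := by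
  obtain ⟨w, hw⟩ := SkewLaurent.exists_remainder (b.isUnit_of_ne_zero (hσ := hσ)) hf
  refine ⟨w, fun j =>
    Submodule.Quotient.mk (SkewMonoidAlgebra.single (Multiplicative.ofAdd (j : ℤ)) 1), fun x => ?_⟩
  obtain ⟨p, rfl⟩ := Submodule.Quotient.mk_surjective _ x
  obtain ⟨q, hq⟩ := hw p
  refine ⟨fun j => (p - q * f).coeff (Multiplicative.ofAdd (j : ℤ)), ?_⟩
  have h1 : (Submodule.Quotient.mk p : b.L hσ f) = Submodule.Quotient.mk (p - q * f) := by
    rw [Submodule.Quotient.eq, sub_sub_cancel]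
    exact Submodule.mem_span_singleton.mpr ⟨q, rfl⟩
  have h2 : p - q * f = ∑ j : Fin w,
      b.const hσ ((p - q * f).coeff (Multiplicative.ofAdd (j : ℤ))) *
        SkewMonoidAlgebra.single (Multiplicative.ofAdd (j : ℤ)) 1 := by
    have h3 : ∀ j : Fin w, b.const hσ ((p - q * f).coeff (Multiplicative.ofAdd (j : ℤ))) *
        SkewMonoidAlgebra.single (Multiplicative.ofAdd (j : ℤ)) 1 =
        SkewMonoidAlgebra.single (Multiplicative.ofAdd (j : ℤ))
          ((p - q * f).coeff (Multiplicative.ofAdd (j : ℤ))) := by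
      intro j
      change SkewMonoidAlgebra.single 1 _ * _ = _
      rw [SkewMonoidAlgebra.single_mul_single, smul_one, mul_one, one_mul]
    simp only [h3]
    generalize p - q * f = p' at hq
    have hinj : Function.Injective (fun j : Fin w => Multiplicative.ofAdd (j : ℤ)) := by
      intro i j h
      have := Multiplicative.ofAdd.injective h
      exact Fin.ext (by exact_mod_cast this)
    conv_lhs => rw [← SkewMonoidAlgebra.sum_single p', SkewMonoidAlgebra.sum_def']
    rw [← Finset.sum_image (s := Finset.univ) (g := fun j : Fin w => Multiplicative.ofAdd (j : ℤ))
      (f := fun i => SkewMonoidAlgebra.single i (p'.coeff i)) (fun i _ j _ h => hinj h)]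
    refine Finset.sum_subset (fun i hi => ?_) (fun i _ hi => ?_)
    · have := hq i (SkewMonoidAlgebra.mem_support_iff.mp hi)
      rw [Finset.mem_image]
      refine ⟨⟨i.toAdd.toNat, by omega⟩, Finset.mem_univ _, ?_⟩
      have h4 : ((i.toAdd.toNat : ℕ) : ℤ) = i.toAdd := by omega
      simp only [h4]
      rfl
    · rw [SkewMonoidAlgebra.notMem_support_iff.mp hi, SkewMonoidAlgebra.single_zero]
  rw [h1]
  conv_lhs => rw [h2]
  exact map_sum (Submodule.mkQ (Submodule.span (b.P hσ) {f})) _ _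

theorem BandSeq.isArtinian_L (f : b.P hσ) (hf : f ≠ 0) : IsArtinian (b.K hσ) (b.L hσ f) := by
  obtain ⟨w, g, hg⟩ := b.exists_generators f hf
  have : Module.Finite (b.K hσ) (b.L hσ f) := by
    classical
    refine ⟨⟨Finset.univ.image g, ?_⟩⟩
    rw [eq_top_iff]
    intro x _
    obtain ⟨k, rfl⟩ := hg x
    refine Submodule.sum_mem _ fun j _ => ?_
    rw [← b.smul_mk]
    exact Submodule.smul_mem _ _ (Submodule.subset_span (by simp))
  infer_instance

end BandSimple

section ShiftStable

variable {hσ : IsEssential σ} {b : BandSeq σ} {f : b.P hσ}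

theorem shift_single_castSucc (d : ℕ) (a : (b.P hσ)ˣ) (i : Fin d) (l : b.L hσ f) :
    shift d a (Pi.single i.castSucc l) = Pi.single i.succ l := by
  ext j
  refine Fin.cases ?_ (fun j => ?_) j
  · rw [shift_zero, Pi.single_eq_of_ne (Fin.castSucc_lt_last i).ne',
      Pi.single_eq_of_ne (Fin.succ_ne_zero i).symm, smul_zero]
  · rw [shift_succ]
    by_cases h : j = i
    · rw [h, Pi.single_eq_same, Pi.single_eq_same]
    · rw [Pi.single_eq_of_ne (by simpa using h), Pi.single_eq_of_ne (by simpa using h)]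

theorem shift_single_last (d : ℕ) (a : (b.P hσ)ˣ) (l : b.L hσ f) :
    shift d a (Pi.single (Fin.last d) l) = Pi.single 0 ((a : b.P hσ) • l) := by
  ext j
  refine Fin.cases ?_ (fun j => ?_) j
  · rw [shift_zero, Pi.single_eq_same, Pi.single_eq_same]
  · rw [shift_succ, Pi.single_eq_of_ne (Fin.castSucc_lt_last j).ne,
      Pi.single_eq_of_ne (Fin.succ_ne_zero j)]

/-- The common part of the simplicity of `M^f` and `N^f`. A nonzero subgroup `U` of `⊕ L_f` stable
under `R`, acting with distinct weights on the summands, and under the shift twisted by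
`a = α^{±1}` is everything: `U` is the sum of its components, and those in the `0`-th summand form
a nonzero `𝐏`-submodule of `L_f`. -/
theorem eq_top_of_shift_stable [IsSimpleModule (b.P hσ) (b.L hσ f)]
    [IsArtinian (b.K hσ) (b.L hσ f)] (a : (b.P hσ)ˣ)
    (ha : a = b.alpha hσ ∨ a = (b.alpha hσ)⁻¹) (τ : b.K hσ →+* b.K hσ)
    (hτ : ∀ k, b.const hσ k * a = a * b.const hσ (τ k))
    (c : Fin (b.d + 1) → R →+* b.P hσ) (hc0 : ∀ r, c 0 r = b.const hσ (b.red hσ r))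
    (n : Fin (b.d + 1) → MaximalSpectrum R) (hn : Function.Injective n)
    (hcn : ∀ i, ∀ r ∈ (n i).asIdeal, c i r = 0) (U : AddSubgroup (Fin (b.d + 1) → b.L hσ f))
    (hU : ∀ r, ∀ v ∈ U, twist c r v ∈ U) (hshift : ∀ v ∈ U, shift b.d a v ∈ U) (hne : U ≠ ⊥) :
    U = ⊤ := by
  classical
  have hcomp : ∀ v ∈ U, ∀ i, Pi.single i (v i) ∈ U := by
    intro v hv i
    -- `r` acts as zero on every copy of `L_f` but the `i`-th.
    obtain ⟨r, hr, hrm⟩ : ∃ r ∈ ∏ j ∈ Finset.univ.erase i, (n j).asIdeal, r ∉ (n i).asIdeal := by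
      by_contra! h
      obtain ⟨j, hj, hji⟩ := (Ideal.IsPrime.prod_le (n i).isMaximal.isPrime).mp
        (show ∏ j ∈ Finset.univ.erase i, (n j).asIdeal ≤ (n i).asIdeal from h)
      exact (Finset.mem_erase.mp hj).1 (hn
        (MaximalSpectrum.ext ((n j).isMaximal.eq_of_le (n i).isMaximal.ne_top hji)))
    obtain ⟨s, hs⟩ := mul_sub_one_mem (n i) hrm
    have h := hU (s * r) v hv
    convert h using 1
    ext j
    rw [twist_apply]
    by_cases hj : j = i
    · subst hj
      have h1 := hcn j _ hs
      rw [map_sub, map_one, sub_eq_zero] at h1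
      rw [h1, one_smul, Pi.single_eq_same]
    · have h1 : s * r ∈ (n j).asIdeal := Ideal.mul_mem_left _ s
        (Ideal.le_of_dvd (Finset.dvd_prod_of_mem _ (Finset.mem_erase.mpr
          ⟨hj, Finset.mem_univ _⟩)) hr)
      rw [hcn j _ h1, zero_smul, Pi.single_eq_of_ne hj]
  have hup : ∀ l : b.L hσ f, Pi.single 0 l ∈ U → ∀ i, Pi.single i l ∈ U := by
    intro l hl i
    induction i using Fin.induction with
    | zero => exact hl
    | succ i ih =>
      rw [← shift_single_castSucc b.d a]
      exact hshift _ ih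
  have hround : ∀ i, ∀ l : b.L hσ f, Pi.single i l ∈ U → Pi.single 0 ((a : b.P hσ) • l) ∈ U := by
    intro i
    induction i using Fin.reverseInduction with
    | last =>
      intro l hl
      rw [← shift_single_last]
      exact hshift _ hl
    | cast i ih =>
      intro l hl
      refine ih l ?_
      rw [← shift_single_castSucc b.d a]
      exact hshift _ hl
  have hconst : ∀ k, ∀ l : b.L hσ f, Pi.single 0 l ∈ U → Pi.single 0 (b.const hσ k • l) ∈ U := by
    intro k l hl
    obtain ⟨r, rfl⟩ := b.red_surjective hσ k
    convert hU r _ hl using 1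
    ext j
    rw [twist_apply]
    by_cases hj : j = 0
    · subst hj
      rw [hc0, Pi.single_eq_same, Pi.single_eq_same]
    · rw [Pi.single_eq_of_ne hj, Pi.single_eq_of_ne hj, smul_zero]
  let S : Submodule (b.K hσ) (b.L hσ f) :=
    { carrier := {l | Pi.single 0 l ∈ U}
      zero_mem' := by
        change Pi.single 0 0 ∈ U
        rw [Pi.single_zero]
        exact U.zero_mem
      add_mem' := fun {l l'} hl hl' => by
        change Pi.single 0 (l + l') ∈ U
        rw [Pi.single_add]
        exact U.add_mem hl hl'
      smul_mem' := fun k l hl => by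
        rw [b.smul_mk]
        exact hconst k l hl }
  -- `a` maps `S` into itself, hence onto itself by finiteness.
  let A : S →+ S :=
    { toFun := fun l => ⟨(a : b.P hσ) • (l : b.L hσ f), hround 0 l l.2⟩
      map_zero' := Subtype.ext (smul_zero _)
      map_add' := fun l l' => Subtype.ext (smul_add _ _ _) }
  have hA : Function.Surjective A := by
    refine surjective_of_injective_of_isArtinian τ A (fun k l => Subtype.ext ?_) fun l l' h => ?_
    · change k • ((a : b.P hσ) • (l : b.L hσ f)) = (a : b.P hσ) • (τ k • (l : b.L hσ f))
      rw [b.smul_mk, b.smul_mk, smul_smul, smul_smul, hτ]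
    · have h1 : (a : b.P hσ) • (l : b.L hσ f) = (a : b.P hσ) • (l' : b.L hσ f) :=
        congrArg Subtype.val h
      refine Subtype.ext ?_
      have h2 := congrArg (fun x => ((a⁻¹ : (b.P hσ)ˣ) : b.P hσ) • x) h1
      simpa only [smul_smul, Units.inv_mul, one_smul] using h2
  have hmul : ∀ l ∈ S.toAddSubgroup, (a : b.P hσ) • l ∈ S.toAddSubgroup := fun l hl => hround 0 l hl
  have hinv : ∀ l ∈ S.toAddSubgroup, ((a⁻¹ : (b.P hσ)ˣ) : b.P hσ) • l ∈ S.toAddSubgroup := by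
    intro l hl
    obtain ⟨l', hl'⟩ := hA ⟨l, hl⟩
    have h1 : (a : b.P hσ) • (l' : b.L hσ f) = l := congrArg Subtype.val hl'
    rw [← h1, smul_smul, Units.inv_mul, one_smul]
    exact l'.2
  have hP : ∀ p : b.P hσ, ∀ l ∈ S.toAddSubgroup, p • l ∈ S.toAddSubgroup := by
    rcases ha with rfl | rfl
    · exact b.smul_mem_of_stable _ (fun k l hl => hconst k l hl) hmul hinv
    · rw [inv_inv] at hinv
      exact b.smul_mem_of_stable _ (fun k l hl => hconst k l hl) hinv hmul
  let T : Submodule (b.P hσ) (b.L hσ f) :=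
    { S.toAddSubgroup with smul_mem' := fun p l hl => hP p l hl }
  have hT : T ≠ ⊥ := by
    obtain ⟨v, hv, hv0⟩ := U.bot_or_exists_ne_zero.resolve_left hne
    obtain ⟨i, hi⟩ := Function.ne_iff.mp hv0
    intro hbot
    have h1 : (a : b.P hσ) • v i ∈ T := hround i _ (hcomp v hv i)
    rw [hbot, Submodule.mem_bot] at h1
    have h2 := congrArg (fun x => ((a⁻¹ : (b.P hσ)ˣ) : b.P hσ) • x) h1
    simp only [smul_smul, Units.inv_mul, one_smul, smul_zero] at h2
    exact hi h2
  have hTtop : T = ⊤ := (eq_bot_or_eq_top T).resolve_left hT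
  rw [eq_top_iff]
  intro v _
  rw [← Finset.univ_sum_single v]
  refine U.sum_mem fun i _ => hup _ ?_ i
  have : v i ∈ T := by rw [hTtop]; trivial
  exact this

end ShiftStable

section BandProperties

/-- The powers of an essential endomorphism are essential. -/
theorem IsEssential.exists_pow_sub_mem (hσ : IsEssential σ) (n : ℕ)
    (m : MaximalSpectrum R) (r : R) : ∃ s, (σ ^ n) s - r ∈ m.asIdeal := by
  induction n generalizing m r with
  | zero => exact ⟨r, by simp⟩
  | succ n ih =>
    obtain ⟨s, hs⟩ := hσ.exists_sub_mem m r
    obtain ⟨s', hs'⟩ := ih (lower hσ m) s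
    have h1 : σ ((σ ^ n) s' - s) ∈ m.asIdeal := hs'
    refine ⟨s', ?_⟩
    have h2 := add_mem h1 hs
    rw [map_sub, sub_add_sub_cancel] at h2
    rw [pow_succ']
    exact h2

variable (hσ : IsEssential σ) (b : BandSeq σ)

theorem bandCoefM_eq_zero (i : Fin (b.d + 1)) {r : R} (hr : r ∈ (b.m (-(i : ℕ))).asIdeal) :
    bandCoefM hσ b i r = 0 := by
  have h := b.pow_mem hr i
  rw [neg_add_cancel] at h
  change b.const hσ (Ideal.Quotient.mk _ ((σ ^ (i : ℕ)) r)) = 0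
  rw [Ideal.Quotient.eq_zero_iff_mem.mpr h]
  exact map_zero _

theorem bandCoefN_eq_zero (i : Fin (b.d + 1)) {r : R} (hr : r ∈ (b.m (i : ℕ)).asIdeal) :
    bandCoefN hσ b i r = 0 := by
  rw [bandCoefN_congr hσ b i (s := 0) (by simpa using hr), map_zero]

theorem bandCoefM_zero (r : R) : bandCoefM hσ b 0 r = b.const hσ (b.red hσ r) := by
  change b.const hσ (b.red hσ ((σ ^ 0) r)) = _
  rw [pow_zero, RingHom.one_def, RingHom.id_apply]

theorem exists_bandCoefM_eq (i : Fin (b.d + 1)) (k : b.K hσ) :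
    ∃ r, bandCoefM hσ b i r = b.const hσ k := by
  obtain ⟨r, rfl⟩ := b.red_surjective hσ k
  obtain ⟨s, hs⟩ := hσ.exists_pow_sub_mem i (b.m 0) r
  exact ⟨s, congrArg (b.const hσ) (Ideal.Quotient.eq.mpr hs)⟩

theorem exists_bandCoefN_eq (i : Fin (b.d + 1)) (k : b.K hσ) :
    ∃ r, bandCoefN hσ b i r = b.const hσ k := by
  obtain ⟨r, rfl⟩ := b.red_surjective hσ k
  exact ⟨_, bandCoefN_pow hσ b i r⟩

theorem BandSeq.weight_injective (hσ : IsEssential σ) (b : BandSeq σ) :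
    Function.Injective fun i : Fin (b.d + 1) => b.m (i : ℕ) := by
  intro i j h
  rcases lt_trichotomy (i : ℕ) (j : ℕ) with hij | hij | hij
  · have := b.period_le_sub hσ (Int.ofNat_lt.mpr hij) h
    omega
  · exact Fin.ext hij
  · have := b.period_le_sub hσ (Int.ofNat_lt.mpr hij) h.symm
    omega

theorem BandSeq.neg_weight_injective (hσ : IsEssential σ) (b : BandSeq σ) :
    Function.Injective fun i : Fin (b.d + 1) => b.m (-((i : ℕ) : ℤ)) := by
  intro i j h
  rcases lt_trichotomy (i : ℕ) (j : ℕ) with hij | hij | hij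
  · have := b.period_le_sub hσ (neg_lt_neg (Int.ofNat_lt.mpr hij)) h.symm
    omega
  · exact Fin.ext hij
  · have := b.period_le_sub hσ (neg_lt_neg (Int.ofNat_lt.mpr hij)) h
    omega

variable {b} {f : b.P hσ}

theorem isSimpleModule_bandM (hf : Irreducible f) : IsSimpleModule (WGWA σ t) (BandM hσ t b f) := by
  have hs : IsSimpleModule (b.P hσ) (b.L hσ f) :=
    SkewLaurent.isSimpleModule_quotient (b.isUnit_of_ne_zero (hσ := hσ)) hf
  have := b.isArtinian_L f hf.ne_zero
  have : Nontrivial (b.L hσ f) := IsSimpleModule.nontrivial (b.P hσ) _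
  have : Nontrivial (BandM hσ t b f) :=
    inferInstanceAs (Nontrivial (Fin (b.d + 1) → b.L hσ f))
  refine (isSimpleModule_iff _ _).mpr { eq_bot_or_eq_top := fun W => ?_ }
  by_cases hW : W = ⊥
  · exact Or.inl hW
  right
  let U : AddSubgroup (Fin (b.d + 1) → b.L hσ f) := W.toAddSubgroup
  have hU : ∀ r, ∀ v ∈ U, twist (bandCoefM hσ b) r v ∈ U := fun r (v : BandM hσ t b f) hv =>
    (congrArg (· ∈ W) (BandM.coef_smul r v)).mp (W.smul_mem (coef σ t r) hv)
  have hshift : ∀ v ∈ U, shift b.d (b.alpha hσ)⁻¹ v ∈ U := fun (v : BandM hσ t b f) hv =>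
    (congrArg (· ∈ W) (BandM.Y_smul v)).mp (W.smul_mem (Y σ t) hv)
  have hτ : ∀ k, b.const hσ k * ((b.alpha hσ)⁻¹ : (b.P hσ)ˣ) =
      ((b.alpha hσ)⁻¹ : (b.P hσ)ˣ) * b.const hσ (RingEquiv.toRingHom (b.sigmaBar hσ) k) :=
    fun k => b.const_mul_alpha_inv hσ k
  have key := eq_top_of_shift_stable (b.alpha hσ)⁻¹ (Or.inr rfl)
    (RingEquiv.toRingHom (b.sigmaBar hσ)) hτ (bandCoefM hσ b) (bandCoefM_zero hσ b) _
    (b.neg_weight_injective hσ) (fun i r hr => bandCoefM_eq_zero hσ b i hr) U hU hshift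
    (fun h => hW (Submodule.toAddSubgroup_injective h))
  exact Submodule.toAddSubgroup_injective key

theorem isSimpleModule_bandN (hf : Irreducible f) : IsSimpleModule (WGWA σ t) (BandN hσ t b f) := by
  have hs : IsSimpleModule (b.P hσ) (b.L hσ f) :=
    SkewLaurent.isSimpleModule_quotient (b.isUnit_of_ne_zero (hσ := hσ)) hf
  have := b.isArtinian_L f hf.ne_zero
  have : Nontrivial (b.L hσ f) := IsSimpleModule.nontrivial (b.P hσ) _
  have : Nontrivial (BandN hσ t b f) :=
    inferInstanceAs (Nontrivial (Fin (b.d + 1) → b.L hσ f))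
  refine (isSimpleModule_iff _ _).mpr { eq_bot_or_eq_top := fun W => ?_ }
  by_cases hW : W = ⊥
  · exact Or.inl hW
  right
  let U : AddSubgroup (Fin (b.d + 1) → b.L hσ f) := W.toAddSubgroup
  have hU : ∀ r, ∀ v ∈ U, twist (bandCoefN hσ b) r v ∈ U := fun r (v : BandN hσ t b f) hv =>
    (congrArg (· ∈ W) (BandN.coef_smul r v)).mp (W.smul_mem (coef σ t r) hv)
  have hshift : ∀ v ∈ U, shift b.d (b.alpha hσ) v ∈ U := fun (v : BandN hσ t b f) hv =>
    (congrArg (· ∈ W) (BandN.X_smul v)).mp (W.smul_mem (X σ t) hv)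
  have key := eq_top_of_shift_stable (b.alpha hσ) (Or.inl rfl) ((b.sigmaBar hσ).symm : _ →+* _)
    (fun k => by
      rw [b.alpha_mul_const]
      congr 2
      exact ((b.sigmaBar hσ).apply_symm_apply k).symm)
    (bandCoefN hσ b) (fun r => bandCoefN_pow hσ b 0 r) _ (b.weight_injective hσ)
    (fun i r hr => bandCoefN_eq_zero hσ b i hr) U hU hshift
    (fun h => hW (Submodule.toAddSubgroup_injective h))
  exact Submodule.toAddSubgroup_injective key

end BandProperties

/-! ### Weights and length of the two families -/

section FiniteLength

variable {V : Type v} [AddCommGroup V] [Module (WGWA σ t) V]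

theorem isWeight_and_finiteLength_of_equiv {W : Type*} [AddCommGroup W] [Module (WGWA σ t) W]
    (e : V ≃ₗ[WGWA σ t] W) {ι : Type*} [Fintype ι] (m : ι → MaximalSpectrum R) (w : ι → W)
    (hw : ∀ i, ∀ r ∈ (m i).asIdeal, coef σ t r • w i = 0)
    (hspan : ∀ v, ∃ c : ι → R, v = ∑ i, coef σ t (c i) • w i) :
    IsWeight σ t V ∧ FiniteLengthOverBase σ t V := by
  refine isWeight_and_finiteLength m (fun i => e.symm (w i)) (fun i r hr => ?_) fun v => ?_
  · rw [← map_smul, hw i r hr, map_zero]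
  · obtain ⟨c, hc⟩ := hspan (e v)
    refine ⟨c, ?_⟩
    rw [← e.symm_apply_apply v, hc, map_sum]
    exact Finset.sum_congr rfl fun i _ => map_smul _ _ _

theorem IsBoundedString.isWeight_and_finiteLength {hσ : IsEssential σ}
    (h : IsBoundedString hσ t V) : IsWeight σ t V ∧ FiniteLengthOverBase σ t V := by
  obtain ⟨n, s, ⟨e⟩⟩ := h
  let w : Fin (n + 1) → BoundedString hσ s := fun i => (Pi.single i 1 : ∀ i, Res (s.m i))
  have hw : ∀ r i j, (coef σ t r • w i) j = r • (Pi.single i 1 : ∀ i, Res (s.m i)) j :=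
    fun r i j => BoundedString.coef_smul hσ s r _ j
  refine isWeight_and_finiteLength_of_equiv e s.m w (fun i r hr => ?_) fun v => ?_
  · funext j
    rw [hw]
    by_cases hj : j = i
    · subst hj
      exact smul_res_eq_zero hr _
    · rw [Pi.single_eq_of_ne hj]
      exact smul_zero r
  · choose c hc using fun i => Ideal.Quotient.mk_surjective (v i)
    refine ⟨c, funext fun j => ?_⟩
    refine Eq.trans ?_ (Finset.sum_apply (M := fun i => Res (s.m i)) j Finset.univ _).symm
    rw [Finset.sum_eq_single j, hw, Pi.single_eq_same, ← hc]
    · rw [Algebra.smul_def, mul_one]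
      rfl
    · intro i _ hi
      rw [hw, Pi.single_eq_of_ne hi.symm]
      exact smul_zero _
    · exact fun h => absurd (Finset.mem_univ _) h

/-- A finite direct sum of copies of `L_f`, with `R` acting through `𝕜` and with weight `n i` on
the `i`-th copy, is a weight module of finite length. -/
theorem isWeight_and_finiteLength_of_twist {hσ : IsEssential σ} {b : BandSeq σ} {f : b.P hσ}
    (hf : f ≠ 0) (c : Fin (b.d + 1) → R →+* b.P hσ) (n : Fin (b.d + 1) → MaximalSpectrum R)
    (hcn : ∀ i, ∀ r ∈ (n i).asIdeal, c i r = 0) (hck : ∀ i k, ∃ r, c i r = b.const hσ k)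
    (e : V ≃+ (Fin (b.d + 1) → b.L hσ f)) (he : ∀ r v, e (coef σ t r • v) = twist c r (e v)) :
    IsWeight σ t V ∧ FiniteLengthOverBase σ t V := by
  obtain ⟨w, g, hg⟩ := b.exists_generators f hf
  have hsingle : ∀ r (i : Fin (b.d + 1)) (l : b.L hσ f),
      twist c r (Pi.single i l) = Pi.single i (c i r • l) := by
    intro r i l
    ext j
    rw [twist_apply]
    by_cases hj : j = i
    · subst hj
      rw [Pi.single_eq_same, Pi.single_eq_same]
    · rw [Pi.single_eq_of_ne hj, Pi.single_eq_of_ne hj, smul_zero]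
  refine isWeight_and_finiteLength (ι := Fin (b.d + 1) × Fin w) (fun p => n p.1)
    (fun p => e.symm (Pi.single p.1 (g p.2))) (fun p r hr => ?_) fun v => ?_
  · refine e.injective ?_
    rw [he, e.apply_symm_apply, hsingle, hcn _ r hr, zero_smul, Pi.single_zero, map_zero]
  · choose k hk using fun i => hg (e v i)
    choose r hr using fun i j => hck i (k i j)
    refine ⟨fun p => r p.1 p.2, e.injective ?_⟩
    rw [map_sum, Fintype.sum_prod_type, ← Finset.univ_sum_single (e v)]
    refine Finset.sum_congr rfl fun i _ => ?_
    rw [hk i, ← AddMonoidHom.single_apply, map_sum]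
    refine Finset.sum_congr rfl fun j _ => ?_
    rw [he, e.apply_symm_apply, hsingle, hr]
    rfl

theorem isWeight_and_finiteLength_of_bandM {hσ : IsEssential σ} {b : BandSeq σ} {f : b.P hσ}
    (hf : f ≠ 0) (e : V ≃ₗ[WGWA σ t] BandM hσ t b f) :
    IsWeight σ t V ∧ FiniteLengthOverBase σ t V :=
  isWeight_and_finiteLength_of_twist hf (bandCoefM hσ b) (fun i => b.m (-((i : ℕ) : ℤ)))
    (fun i _ hr => bandCoefM_eq_zero hσ b i hr) (exists_bandCoefM_eq hσ b) e.toAddEquiv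
    fun r v => (e.map_smul (coef σ t r) v).trans (BandM.coef_smul r (e v))

theorem isWeight_and_finiteLength_of_bandN {hσ : IsEssential σ} {b : BandSeq σ} {f : b.P hσ}
    (hf : f ≠ 0) (e : V ≃ₗ[WGWA σ t] BandN hσ t b f) :
    IsWeight σ t V ∧ FiniteLengthOverBase σ t V :=
  isWeight_and_finiteLength_of_twist hf (bandCoefN hσ b) (fun i => b.m (i : ℕ))
    (fun i _ hr => bandCoefN_eq_zero hσ b i hr) (exists_bandCoefN_eq hσ b) e.toAddEquiv
    fun r v => (e.map_smul (coef σ t r) v).trans (BandN.coef_smul r (e v))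

end FiniteLength

/-! ### The classification -/

section Classification

variable {V : Type v} [AddCommGroup V] [Module (WGWA σ t) V]

/-- By Schur's lemma, a simple module receiving a nonzero map from `M^f` is isomorphic to it. -/
theorem IsBand.of_homM {hσ : IsEssential σ} [IsSimpleModule (WGWA σ t) V] {b : BandSeq σ}
    {f : b.P hσ} (hf : Irreducible f) (G : BandM hσ t b f →ₗ[WGWA σ t] V) (hG : G ≠ 0) :
    IsBand hσ t V := by
  have := isSimpleModule_bandM (t := t) hσ hf
  exact ⟨b, f, hf, Or.inl ⟨(LinearEquiv.ofBijective G (G.bijective_of_ne_zero hG)).symm⟩⟩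

/-- By Schur's lemma, a simple module receiving a nonzero map from `N^f` is isomorphic to it. -/
theorem IsBand.of_homN {hσ : IsEssential σ} [IsSimpleModule (WGWA σ t) V] {b : BandSeq σ}
    {f : b.P hσ} (hf : Irreducible f) (G : BandN hσ t b f →ₗ[WGWA σ t] V) (hG : G ≠ 0) :
    IsBand hσ t V := by
  have := isSimpleModule_bandN (t := t) hσ hf
  exact ⟨b, f, hf, Or.inr ⟨(LinearEquiv.ofBijective G (G.bijective_of_ne_zero hG)).symm⟩⟩

variable [Module R V]

/-- An injective operator `y` with `r y = y σ(r)` on a module of finite length singles out a band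
sequence and a copy of some `L_f` in the weight space of `𝔪_0`, with `α⁻¹` acting as `yᵏ`. -/
theorem exists_quotient_of_injective (hσ : IsEssential σ) [IsArtinian R V] [IsNoetherian R V]
    [Nontrivial V] (y : V →+ V) (hy : ∀ (r : R) v, r • y v = y (σ r • v))
    (hinj : Function.Injective y) :
    ∃ (b : BandSeq σ) (f : b.P hσ), Irreducible f ∧ ∃ φ : b.L hσ f →+ V, (∃ x, φ x ≠ 0) ∧
      (∀ x, HasWeight (b.m 0) (φ x)) ∧
      (∀ r x, φ (b.const hσ (b.red hσ r) • x) = r • φ x) ∧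
      ∀ x, y^[b.d + 1] (φ ((b.alpha hσ : b.P hσ) • x)) = φ x := by
  obtain ⟨m, v, hv, hv0, k, hk, hm⟩ := exists_periodic_weight hσ y hy hinj
  obtain ⟨b, rfl⟩ := exists_bandSeq hσ hk hm
  exact ⟨b, exists_quotient_to_weightSpace hσ b y hy hinj hv hv0⟩

/-- The kernel of `X` is an `R`-submodule, so that it contains a weight vector if it is not zero. -/
theorem exists_X_smul_eq_zero (hc : ∀ (r : R) (v : V), coef σ t r • v = r • v) [IsArtinian R V]
    (h : ¬ Function.Injective (opX σ t V)) :
    ∃ (m : MaximalSpectrum R) (u : V), HasWeight m u ∧ u ≠ 0 ∧ X σ t • u = 0 := by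
  let U : Submodule R V :=
    { (opX σ t V).ker with
      smul_mem' := fun r v (hv : X σ t • v = 0) => by
        change X σ t • r • v = 0
        rw [X_smul_smul hc, hv, smul_zero] }
  have hU : U ≠ ⊥ := by
    rw [injective_iff_map_eq_zero] at h
    push Not at h
    obtain ⟨v, hv, hv0⟩ := h
    intro hbot
    have : v ∈ U := hv
    rw [hbot] at this
    exact hv0 this
  obtain ⟨u, hu, hu0, m, hm⟩ := exists_hasWeight hU
  exact ⟨m, u, hm, hu0, hu⟩

theorem isBoundedString_or_isBand (hσ : IsEssential σ)
    (hc : ∀ (r : R) (v : V), coef σ t r • v = r • v) [IsSimpleModule (WGWA σ t) V]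
    (hfin : IsFiniteLength R V) : IsBoundedString hσ t V ∨ IsBand hσ t V := by
  obtain ⟨_, _⟩ := isFiniteLength_iff_isNoetherian_isArtinian.mp hfin
  have : Nontrivial V := IsSimpleModule.nontrivial (WGWA σ t) V
  have hess : ∀ m : Ideal R, m.IsMaximal → ∀ s, ∃ r, σ r - s ∈ m :=
    fun m hm => hσ.exists_sub_mem ⟨m, hm⟩
  by_cases hinj : Function.Injective (opX σ t V)
  -- `N^f` is the case `y = X⁻¹`, and `M^f` below the case `y = Y`.
  · right
    have hsurj : Function.Surjective (opX σ t V) :=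
      surjective_of_injective_of_twisted σ hess hfin rfl _ (X_smul_smul hc) hinj
    let x : V ≃+ V := AddEquiv.ofBijective (opX σ t V) ⟨hinj, hsurj⟩
    have hXz : ∀ v, opX σ t V (x.symm v) = v := x.apply_symm_apply
    have hz : ∀ (r : R) v, r • (x.symm : V →+ V) v = (x.symm : V →+ V) (σ r • v) := fun r v =>
      hinj ((X_smul_smul hc r (x.symm v)).trans
        ((congrArg (σ r • ·) (hXz v)).trans (hXz _).symm))
    obtain ⟨b, f, hf, φ, hne, hφm, hφ, hα⟩ :=
      exists_quotient_of_injective hσ (x.symm : V →+ V) hz x.symm.injective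
    obtain ⟨G, hG⟩ := exists_linearMap_bandN hc (x.symm : V →+ V) hz x.symm_apply_apply hXz
      φ hφ hφm hα hne
    exact .of_homN hf G hG
  · obtain ⟨m, u, hm, hu0, hX⟩ := exists_X_smul_eq_zero hc hinj
    by_cases h1 : u ∈ tail σ t u 1
    · right
      have hsurj := opY_surjective hσ hc hm hX hu0 h1
      have hinjY : Function.Injective (opY σ t V) :=
        injective_of_surjective_of_twisted σ hess hfin rfl _ (fun r v => (smul_opY hc r v).symm)
          hsurj
      obtain ⟨b, f, hf, φ, hne, -, hφ, hα⟩ :=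
        exists_quotient_of_injective hσ (opY σ t V) (smul_opY hc) hinjY
      obtain ⟨G, hG⟩ := exists_linearMap_bandM hc φ hφ hα hne
      exact .of_homM hf G hG
    · exact Or.inl (isBoundedString_of_X_smul_eq_zero hσ hc hm hX hu0 h1)

end Classification

end WGWA

theorem corollary4p1 {R : Type u} [CommRing R] (σ : R →+* R) (hσ : WGWA.IsEssential σ) (t : R)
    (V : Type v) [AddCommGroup V] [Module (WGWA σ t) V] :
    (IsSimpleModule (WGWA σ t) V ∧ WGWA.IsWeight σ t V ∧ WGWA.FiniteLengthOverBase σ t V) ↔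
      ((IsSimpleModule (WGWA σ t) V ∧ WGWA.IsBoundedString hσ t V) ∨ WGWA.IsBand hσ t V) := by
  constructor
  · rintro ⟨hs, -, hfin⟩
    let _ : Module R V := Module.compHom V (WGWA.coef σ t)
    exact (WGWA.isBoundedString_or_isBand hσ (fun _ _ => rfl) hfin).imp (fun h => ⟨hs, h⟩) id
  · rintro (⟨hs, h⟩ | ⟨b, f, hf, he | he⟩)
    · exact ⟨hs, h.isWeight_and_finiteLength⟩
    · obtain ⟨e⟩ := he
      have := WGWA.isSimpleModule_bandM (t := t) hσ hf
      exact ⟨IsSimpleModule.congr e, WGWA.isWeight_and_finiteLength_of_bandM hf.ne_zero e⟩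
    · obtain ⟨e⟩ := he
      have := WGWA.isSimpleModule_bandN (t := t) hσ hf
      exact ⟨IsSimpleModule.congr e, WGWA.isWeight_and_finiteLength_of_bandN hf.ne_zero e⟩
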